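/- Let $\Sigma$ be a finite alphabet and $k\in\mathbb N$. Let $\mathbb Z\mathsf{Poly}[k]$ be the set of functions $f\colon\Sigma^*\to\mathbb Z$ for which there are a finite monoid $M$, a monoid morphism $\mu\colon\Sigma^*\to M$ and a map $\pi\colon M^{k+1}\to\mathbb Z$ with $$f(w)=\sum_{w=u_1\cdots u_{k+1}}\pi(\mu(u_1),\dots,\mu(u_{k+1}))\qquad\text{for all } w\in\Sigma^*,$$ the sum ranging over all factorizations of $w$ into $k+1$ possibly empty words. Let $\mathbb N\mathsf{SF}[k]$ be the set of those $f$ for which one can moreover choose $M$ aperiodic (for every $x\in M$ there is $n$ with $x^{n+1}=x^n$) and $\pi$ with values in $\mathbb N$; put $\mathbb N\mathsf{SF}[-1]=\{0\}$. A function on $\Sigma^*$ is commutative if its value does not change when the letters of its argument are permuted. Write $u\trianglelefteq v$ if the function $w\mapsto f(vw)-f(uw)$ belongs to $\mathbb N\mathsf{SF}[k-1]$. A relation on $\Sigma^*$ is a well-quasi-ordering if it is reflexive and transitive and every infinite sequence $(x_n)$ has indices $i<j$ with $x_i$ below $x_j$; it is aperiodic if for all $u,w\in\Sigma^*$ there is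 $N_0$ such that $(uw^n)_{n\ge N_0}$ is non-decreasing. A pumping pattern $q\colon\mathbb N^p\to\Sigma^*$ is a map $q(x)=\alpha_0\,u_1^{x_1}\alpha_1\cdots u_p^{x_p}\alpha_p$ with $\alpha_i,u_i\in\Sigma^*$. The function $f$ is ultimately polynomial if there is $N_0\in\mathbb N$ such that for every $p\in\mathbb N$ and every pumping pattern $q\colon\mathbb N^p\to\Sigma^*$ there is $P\in\mathbb Q[X_1,\dots,X_p]$ with $f(q(x))=P(x)$ for all $x\in(\mathbb N_{\ge N_0})^p$. A natural binomial polynomial is a linear combination, with coefficients in $\mathbb N$, of products of the form $\prod_j\frac{(X_j-\ell_j)(X_j-\ell_j-1)\cdots(X_j-\ell_j-m_j+1)}{m_j!}$ with $\ell_j,m_j\in\mathbb N$. A polynomial over $\mathbb Q$ is a strongly natural binomial polynomial if, whenever some (possibly none, possibly all) of its indeterminates are replaced by elements of $\mathbb N$, the resulting polynomial in the remaining indeterminates is a natural binomial polynomial. The function $f$ is combinatorial if, with $p=|\Sigma|$, there is an integer $\omega\ge1$ such that for every pumping pattern $q\colon\mathbb N^p\to\Sigma^*$ there is a strongly natural binomial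 polynomial $P\in\mathbb Q[X_1,\dots,X_p]$ with $f(q(\omega(x_1+1),\dots,\omega(x_p+1)))=P(x_1,\dots,x_p)$ for all $x\in\mathbb N^p$. Theorem. Let $f\in\mathbb Z\mathsf{Poly}[k]$ be commutative. The following are equivalent: 1. $f\in\mathbb N\mathsf{SF}[k]$; 2. $f$ takes only non-negative values, and $(\Sigma^*,\trianglelefteq)$ is an aperiodic well-quasi-ordering; 3. $f$ is ultimately polynomial and combinatorial. -/

import Mathlib

namespace Polyreg

open MvPolynomial

/-- A monoid is aperiodic when every element `x` satisfies `x ^ (n + 1) = x ^ n` for some `n`. -/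
def AperiodicMonoid (M : Type) [Monoid M] : Prop :=
  ∀ x : M, ∃ n : ℕ, x ^ (n + 1) = x ^ n

/-- The decompositions `w = u₁ ⋯ uₙ` of a word `w` into `n` (possibly empty) factors. -/
def factorizations {A : Type*} (n : ℕ) (w : FreeMonoid A) : Set (Fin n → FreeMonoid A) :=
  {u | (List.ofFn u).prod = w}

theorem isInfix_prod_of_mem {A : Type*} (l : List (FreeMonoid A)) (x : FreeMonoid A)
    (hx : x ∈ l) : x.toList <:+: l.prod.toList := by
  induction l with
  | nil => simp at hx
  | cons a t ih =>
    rw [List.prod_cons, FreeMonoid.toList_mul]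
    rcases List.mem_cons.1 hx with rfl | h
    · exact List.infix_append' [] _ _
    · exact (ih h).trans (List.suffix_append _ _).isInfix

theorem factorizations_finite {A : Type*} (n : ℕ) (w : FreeMonoid A) :
    (factorizations n w).Finite := by
  have hfin : {x : FreeMonoid A | x.toList ∈ w.toList.sublists}.Finite :=
    List.finite_toSet w.toList.sublists
  refine (Set.Finite.pi' (fun _ : Fin n => hfin)).subset ?_
  intro u hu i
  have hi : u i ∈ List.ofFn u := (List.mem_ofFn' u (u i)).2 ⟨i, rfl⟩
  have h := isInfix_prod_of_mem (List.ofFn u) (u i) hi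
  have hw : (List.ofFn u).prod = w := hu
  rw [hw] at h
  exact List.mem_sublists.2 h.sublist

/-- `∑ π (μ u₁, …, μ uₙ)` over all decompositions `w = u₁ ⋯ uₙ`. -/
noncomputable def productionSum {A : Type*} {M : Type} [Monoid M] {n : ℕ}
    (μ : FreeMonoid A →* M) (π : (Fin n → M) → ℤ) (w : FreeMonoid A) : ℤ :=
  ∑ u ∈ (factorizations_finite n w).toFinset, π (fun i => μ (u i))

/-- The ℤ-polyregular functions of degree at most `d`. -/
def ZPoly (A : Type*) (d : ℕ) : Set (FreeMonoid A → ℤ) :=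
  {f | ∃ (M : Type) (_ : Monoid M) (_ : Finite M) (μ : FreeMonoid A →* M)
      (π : (Fin (d + 1) → M) → ℤ), ∀ w, f w = productionSum μ π w}

/-- The star-free ℕ-polyregular functions of degree at most `d`: the monoid is aperiodic and the
production function takes its values in ℕ. -/
def NSF (A : Type*) (d : ℕ) : Set (FreeMonoid A → ℤ) :=
  {f | ∃ (M : Type) (_ : Monoid M) (_ : Finite M) (μ : FreeMonoid A →* M)
      (π : (Fin (d + 1) → M) → ℕ), AperiodicMonoid M ∧
        ∀ w, f w = productionSum μ (fun m => (π m : ℤ)) w}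

/-- The class of star-free ℕ-polyregular functions of degree at most `k - 1`; for `k = 0` it
contains only the zero function. -/
def NSFPred (A : Type*) : ℕ → Set (FreeMonoid A → ℤ)
  | 0 => {fun _ => 0}
  | d + 1 => NSF A d

/-- Invariance under permutations of the letters of the input. -/
def Commutative {A : Type*} (f : FreeMonoid A → ℤ) : Prop :=
  ∀ u v : FreeMonoid A, u.toList.Perm v.toList → f u = f v

/-- The star-free residual preorder: `u ≤ v` when `w ↦ f (v w) - f (u w)` is star-free
ℕ-polyregular of degree at most `k - 1`. -/
def ResLE {A : Type*} (f : FreeMonoid A → ℤ) (k : ℕ) (u v : FreeMonoid A) : Prop :=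
  (fun w => f (v * w) - f (u * w)) ∈ NSFPred A k

/-- A well-quasi-ordering: a quasi-ordering in which every infinite sequence is good. -/
def IsWQO {X : Type*} (r : X → X → Prop) : Prop :=
  (∀ x, r x x) ∧ (∀ x y z, r x y → r y z → r x z) ∧
    ∀ s : ℕ → X, ∃ i j, i < j ∧ r (s i) (s j)

/-- An ordering of words is aperiodic when every sequence `(u wⁿ)ₙ` is ultimately
non-decreasing. -/
def AperiodicOrdering {A : Type*} (r : FreeMonoid A → FreeMonoid A → Prop) : Prop :=
  ∀ u w : FreeMonoid A, ∃ N₀ : ℕ, ∀ m n : ℕ, N₀ ≤ m → m ≤ n → r (u * w ^ m) (u * w ^ n)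

/-- The pumping pattern `x ↦ α₀ (u₁ ^ x₁) α₁ ⋯ (uₚ ^ xₚ) αₚ`. -/
def pumping {A : Type*} {p : ℕ} (α₀ : FreeMonoid A) (u α : Fin p → FreeMonoid A)
    (x : Fin p → ℕ) : FreeMonoid A :=
  α₀ * (List.ofFn fun i => u i ^ x i * α i).prod

/-- `f` is ultimately polynomial; the threshold `N₀` is uniform in the pumping pattern. -/
def UltimatelyPolynomial {A : Type*} (f : FreeMonoid A → ℤ) : Prop :=
  ∃ N₀ : ℕ, ∀ (p : ℕ) (α₀ : FreeMonoid A) (u α : Fin p → FreeMonoid A),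
    ∃ P : MvPolynomial (Fin p) ℚ, ∀ x : Fin p → ℕ, (∀ i, N₀ ≤ x i) →
      (f (pumping α₀ u α x) : ℚ) = eval (fun i => (x i : ℚ)) P

/-- The binomial monomial `(X - ℓ)(X - ℓ - 1) ⋯ (X - ℓ - m + 1) / m!` in the indeterminate
`X = X_j`. -/
noncomputable def binomialMonomial {σ : Type*} (j : σ) (ℓ m : ℕ) : MvPolynomial σ ℚ :=
  C ((m.factorial : ℚ)⁻¹) * ∏ t ∈ Finset.range m, (X j - C ((ℓ + t : ℕ) : ℚ))

/-- ℕ-linear combinations of products of binomial monomials. -/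
def IsNaturalBinomial {σ : Type*} [Fintype σ] (P : MvPolynomial σ ℚ) : Prop :=
  ∃ (n : ℕ) (c : Fin n → ℕ) (ℓ m : Fin n → σ → ℕ),
    P = ∑ i, c i • ∏ j, binomialMonomial j (ℓ i j) (m i j)

/-- The restriction of `P` by a partial valuation `ν`: the indeterminates where `ν` is defined
are replaced by their values, the others remain. -/
noncomputable def restrictBy {σ : Type*} (P : MvPolynomial σ ℚ) (ν : σ → Option ℕ) :
    MvPolynomial {j : σ // ν j = none} ℚ :=
  aeval (fun j => if h : ν j = none then X ⟨j, h⟩ else C (((ν j).getD 0 : ℕ) : ℚ)) P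

/-- All restrictions by partial valuations in ℕ are natural binomial polynomials. -/
def IsStronglyNaturalBinomial {σ : Type*} [Fintype σ] (P : MvPolynomial σ ℚ) : Prop :=
  ∀ ν : σ → Option ℕ, IsNaturalBinomial (restrictBy P ν)

/-- `f` is `(p, ℕ)`-combinatorial. The pattern is evaluated at `ω y₁, …, ω yₚ` for `yᵢ ≥ 1`,
and `xᵢ = yᵢ - 1` are taken as the indeterminates, so that the values `P (x)`, for `x` in `ℕ ^ p`,
are exactly the values of `f` along the pattern. -/
def Combinatorial {A : Type*} (p : ℕ) (f : FreeMonoid A → ℤ) : Prop :=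
  ∃ ω : ℕ, 1 ≤ ω ∧ ∀ (α₀ : FreeMonoid A) (u α : Fin p → FreeMonoid A),
    ∃ P : MvPolynomial (Fin p) ℚ, IsStronglyNaturalBinomial P ∧ ∀ x : Fin p → ℕ,
      (f (pumping α₀ u α fun i => ω * (x i + 1)) : ℚ) = eval (fun i => (x i : ℚ)) P

end Polyreg

/-! A commutative `f` is a function `F` of the Parikh vector, and all three conditions are
equivalent to `NormalForm (k + 1) F`: for some threshold `T`, once the coordinates below `T` are
frozen, `F` is in the others a polynomial of degree at most `k` with non-negative Newton
coefficients. Such functions (`AbsMono`) are defined by iterated differences, so every claim becomes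
an induction on the degree.

Star-free membership is equivalent to the normal form (`normalForm_iff`). Differences can be summed
back along the letters of a word, and an aperiodic monoid can count letters up to a threshold.
Conversely, aperiodicity makes the residual at `a ^ (N + 1)` minus the residual at `a ^ N` star-free
of lower degree, and `NormalForm.of_residuals` integrates these differences.

For the residual order, the normal form makes `u` lie below `v` as soon as their counts agree
wherever they are not both past `T` and increasing; Dickson's lemma applies to this relation.
Conversely, the aperiodicity of the order along the powers of each letter supplies the differences
needed by `NormalForm.of_residuals`.

For pumping patterns, the normal form survives linear substitutions, and Newton's formula yields the
polynomials. Conversely, combinatoriality gives positivity on a sublattice, ultimate polynomiality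
carries it to all large arguments, and polynomial growth bounds the degree by `k`. The resulting
thresholds depend on the frozen values; `exists_uniform_absMono` makes them uniform. -/

namespace Polyreg

open MvPolynomial

/-! ### Absolutely monotone functions on tuples of natural numbers. -/

section AbsMono

variable {σ τ R : Type*} [CommRing R] [LinearOrder R] [IsStrictOrderedRing R]

/-- Induction on tuples of natural numbers by incrementing one coordinate at a time. -/
theorem tuple_induction [Fintype σ] [DecidableEq σ] {p : (σ → ℕ) → Prop} (h0 : p 0)
    (hs : ∀ v a, p v → p (v + Pi.single a 1)) (v : σ → ℕ) : p v := by
  induction hn : ∑ a, v a generalizing v with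
  | zero =>
    have : v = 0 := by
      funext a
      exact (Finset.sum_eq_zero_iff.1 hn) a (Finset.mem_univ a)
    exact this ▸ h0
  | succ n ih =>
    obtain ⟨a, -, ha⟩ : ∃ a ∈ Finset.univ, v a ≠ 0 :=
      Finset.exists_ne_zero_of_sum_ne_zero (by omega)
    have hv : v = (v - Pi.single a 1) + Pi.single a 1 := by
      funext b
      by_cases hb : b = a
      · subst hb; simp; omega
      · simp [hb]
    rw [hv]
    refine hs _ _ (ih _ ?_)
    rw [hv] at hn
    simp only [Pi.add_apply, Finset.sum_add_distrib, Finset.sum_pi_single', Finset.mem_univ,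
      if_true] at hn
    have : ∑ x, (Pi.single a 1 : σ → ℕ) x = 1 := by simp
    omega

/-- `g` is a polynomial function on `ℕ ^ σ` of degree less than `d` whose iterated forward
differences at the origin are all non-negative. -/
def AbsMono [DecidableEq σ] : ℕ → ((σ → ℕ) → R) → Prop
  | 0, g => g = 0
  | d + 1, g => 0 ≤ g 0 ∧ ∀ a, AbsMono d (fwdDiff (Pi.single a 1) g)

namespace AbsMono

variable [DecidableEq σ] [DecidableEq τ] {d e : ℕ} {g h : (σ → ℕ) → R}

omit [IsStrictOrderedRing R] in
theorem zero (d : ℕ) : AbsMono d (0 : (σ → ℕ) → R) := by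
  induction d with
  | zero => rfl
  | succ d ih =>
    refine ⟨le_rfl, fun a => ?_⟩
    have : fwdDiff (Pi.single a 1) (0 : (σ → ℕ) → R) = 0 := by funext y; simp [fwdDiff]
    rwa [this]

theorem add (hg : AbsMono d g) (hh : AbsMono d h) : AbsMono d (g + h) := by
  induction d generalizing g h with
  | zero => rw [AbsMono] at *; simp [hg, hh]
  | succ d ih =>
    refine ⟨add_nonneg hg.1 hh.1, fun a => ?_⟩
    rw [fwdDiff_add]
    exact ih (hg.2 a) (hh.2 a)

omit [IsStrictOrderedRing R] in
theorem succ (hg : AbsMono d g) : AbsMono (d + 1) g := by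
  induction d generalizing g with
  | zero => rw [AbsMono] at hg; subst hg; exact zero 1
  | succ d ih => exact ⟨hg.1, fun a => ih (hg.2 a)⟩

omit [IsStrictOrderedRing R] in
theorem mono (hg : AbsMono d g) (hde : d ≤ e) : AbsMono e g := by
  induction hde with
  | refl => exact hg
  | step _ ih => exact ih.succ

omit [IsStrictOrderedRing R] in
theorem fwdDiff_single (hg : AbsMono d g) (a : σ) : AbsMono d (fwdDiff (Pi.single a 1) g) := by
  cases d with
  | zero =>
    rw [AbsMono] at hg
    subst hg
    funext y
    simp [fwdDiff]
  | succ d => exact (hg.2 a).succ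

theorem shift [Fintype σ] (hg : AbsMono d g) (v : σ → ℕ) : AbsMono d (fun y => g (y + v)) := by
  induction v using tuple_induction with
  | h0 => simpa using hg
  | hs v a ih =>
    have : (fun y => g (y + (v + Pi.single a 1))) =
        (fun y => g (y + v)) + fwdDiff (Pi.single a 1) (fun y => g (y + v)) := by
      funext y
      simp only [fwdDiff, Pi.add_apply, add_sub_cancel]
      congr 1
      abel
    rw [this]
    exact ih.add (ih.fwdDiff_single a)

theorem nonneg [Fintype σ] (hg : AbsMono d g) (y : σ → ℕ) : 0 ≤ g y := by
  have := hg.shift y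
  cases d with
  | zero => rw [AbsMono] at hg; simp [hg]
  | succ d => simpa using this.1

/-- A step by `v` is a path of unit steps, so this difference is a sum of translated unit
differences, each of lower degree. -/
theorem fwdDiff [Fintype σ] (hg : AbsMono (d + 1) g) (v : σ → ℕ) :
    AbsMono d (fwdDiff v g) := by
  induction v using tuple_induction with
  | h0 =>
    have : _root_.fwdDiff 0 g = 0 := by funext y; simp [_root_.fwdDiff]
    rw [this]
    exact zero d
  | hs v a ih =>
    have : _root_.fwdDiff (v + Pi.single a 1) g =
        (fun y => _root_.fwdDiff (Pi.single a 1) g (y + v)) + _root_.fwdDiff v g := by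
      funext y
      simp only [_root_.fwdDiff, Pi.add_apply, add_assoc]
      ring
    rw [this]
    exact ((hg.2 a).shift v).add ih

theorem monotone [Fintype σ] (hg : AbsMono d g) : Monotone g := by
  intro x y hxy
  have := (hg.succ.fwdDiff (y - x)).nonneg x
  rwa [_root_.fwdDiff, add_tsub_cancel_of_le hxy, sub_nonneg] at this

/-- A unit difference of the composite is a difference of `g` in a fixed direction `u`, composed
with the same `φ`. This covers freezing coordinates, reindexing and linear substitution. -/
theorem comp [Fintype σ] (hg : AbsMono d g) {φ : (τ → ℕ) → (σ → ℕ)}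
    (hφ : ∀ i, ∃ u, ∀ y, φ (y + Pi.single i 1) = φ y + u) :
    AbsMono d (fun y => g (φ y)) := by
  induction d generalizing g with
  | zero => rw [AbsMono] at hg; subst hg; exact zero 0
  | succ d ih =>
    refine ⟨hg.nonneg _, fun i => ?_⟩
    obtain ⟨u, hu⟩ := hφ i
    have : _root_.fwdDiff (Pi.single i 1) (fun y => g (φ y)) =
        fun y => _root_.fwdDiff u g (φ y) := by
      funext y
      simp [_root_.fwdDiff, hu]
    rw [this]
    exact ih (hg.fwdDiff u)

omit [IsStrictOrderedRing R] in
theorem const {c : R} (hc : 0 ≤ c) : AbsMono 1 (fun _ : σ → ℕ => c) := by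
  refine ⟨hc, fun a => ?_⟩
  funext y
  simp [_root_.fwdDiff]

theorem coord (a : σ) : AbsMono 2 (fun y : σ → ℕ => (y a : R)) := by
  refine ⟨by simp, fun b => ?_⟩
  have : _root_.fwdDiff (Pi.single b 1) (fun y : σ → ℕ => (y a : R)) =
      fun _ => ((Pi.single b 1 : σ → ℕ) a : R) := by
    funext y
    simp [_root_.fwdDiff]
  rw [this]
  exact const (by positivity)

/-- The discrete Leibniz rule, by induction on the sum of the two bounds. -/
theorem mul [Fintype σ] (hg : AbsMono d g) (hh : AbsMono e h) : AbsMono (d + e) (g * h) := by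
  induction hn : d + e generalizing d e g h with
  | zero =>
    obtain rfl : d = 0 := by omega
    rw [AbsMono] at *
    simp [hg]
  | succ n ih =>
    rcases d with - | d
    · rw [AbsMono] at hg
      rw [hg, zero_mul]
      exact zero _
    rcases e with - | e
    · have hh' : h = 0 := hh
      rw [hh', mul_zero]
      exact zero _
    refine ⟨mul_nonneg hg.1 hh.1, fun a => ?_⟩
    have : _root_.fwdDiff (Pi.single a 1) (g * h) =
        _root_.fwdDiff (Pi.single a 1) g * h +
          (fun y => g (y + Pi.single a 1)) * _root_.fwdDiff (Pi.single a 1) h := by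
      funext y
      simp only [_root_.fwdDiff, Pi.mul_apply, Pi.add_apply]
      ring
    rw [this]
    exact (ih (hg.2 a) hh (by omega)).add (ih (hg.shift _) (hh.2 a) (by omega))

theorem of_cast {g : (σ → ℕ) → ℤ} (hg : AbsMono d (fun y => (g y : R))) : AbsMono d g := by
  induction d generalizing g with
  | zero =>
    rw [AbsMono] at *
    funext y
    simpa using congrFun hg y
  | succ d ih =>
    refine ⟨by simpa using hg.1, fun a => ih ?_⟩
    convert hg.2 a using 2 with y
    simp [_root_.fwdDiff]

theorem sum {ι : Type*} (s : Finset ι) (g : ι → (σ → ℕ) → R) (hg : ∀ i ∈ s, AbsMono d (g i)) :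
    AbsMono d (∑ i ∈ s, g i) :=
  Finset.sum_induction g (AbsMono d) (fun _ _ => add) (zero d) hg

/-- Polynomial growth of order `k` along the diagonal bounds the degree. -/
theorem of_growth [Fintype σ] {g : (σ → ℕ) → ℤ} (hg : AbsMono d g) (k : ℕ) {C : ℤ}
    (hC : ∀ t : ℕ, 1 ≤ t → g (fun _ => t) ≤ C * t ^ k) : AbsMono (k + 1) g := by
  -- Differences are monotone, so `t` steps in direction `a` from the diagonal point `t` gain at
  -- least `t` times the difference there; the end point lies below the diagonal point `2 * t`.
  -- Differences thus grow one order slower than `g`.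
  have key : ∀ {C : ℤ} {k : ℕ} {g : (σ → ℕ) → ℤ}, AbsMono d g →
      (∀ t : ℕ, 1 ≤ t → g (fun _ => t) ≤ C * t ^ k) → ∀ a : σ, ∀ t : ℕ, 1 ≤ t →
      t * _root_.fwdDiff (Pi.single a 1) g (fun _ => t) ≤ C * 2 ^ k * t ^ k := by
    intro C k g hg hC a t ht
    have h1 : ∀ n : ℕ, n * _root_.fwdDiff (Pi.single a 1) g (fun _ => t) ≤
        g ((fun _ => t) + Pi.single a n) - g (fun _ => t) := by
      intro n
      induction n with
      | zero => simp
      | succ n ih =>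
        have h2 := (hg.fwdDiff_single a).monotone
          (show (fun _ => t) ≤ (fun _ => t) + Pi.single a n from le_self_add)
        simp only [_root_.fwdDiff, add_assoc, ← Pi.single_add] at h2 ih ⊢
        push_cast
        linarith
    have h3 := hC (2 * t) (by omega)
    have h4 : g ((fun _ => t) + Pi.single a t) ≤ g (fun _ => 2 * t) := by
      refine hg.monotone fun b => ?_
      by_cases hb : b = a
      · subst hb; simp; omega
      · simp [hb]; omega
    have h5 := h1 t
    have h6 := hg.nonneg (fun _ => t)
    push_cast at h3
    rw [mul_pow] at h3
    linarith
  induction k generalizing g C with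
  | zero =>
    refine ⟨hg.nonneg 0, fun a => ?_⟩
    funext y
    refine le_antisymm ?_ ((hg.fwdDiff_single a).nonneg y)
    -- This `t` dominates `y` and exceeds `C`, whereas a non-zero difference at the diagonal point
    -- `t` would force `t ≤ C`.
    set t : ℕ := 1 + C.toNat + ∑ b, y b with ht
    have h1 := key hg hC a t (by omega)
    have h2 := (hg.fwdDiff_single a).monotone (show y ≤ fun _ => t from fun b => by
      have := Finset.single_le_sum (f := y) (fun _ _ => Nat.zero_le _) (Finset.mem_univ b)
      simp only [ht]
      omega)
    refine h2.trans ?_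
    by_contra! h3
    have h4 : (1 : ℤ) ≤ _root_.fwdDiff (Pi.single a 1) g (fun _ => t) := h3
    have h5 : (t : ℤ) ≤ C := by
      simp only [pow_zero, mul_one] at h1
      nlinarith
    omega
  | succ k ih =>
    refine ⟨hg.nonneg 0, fun a => ih (hg.fwdDiff_single a) (C := C * 2 ^ (k + 1)) ?_⟩
    intro t ht
    have h1 := key hg hC a t ht
    have : (0 : ℤ) < t := by exact_mod_cast ht
    refine le_of_mul_le_mul_left ?_ this
    calc _ ≤ _ := h1
      _ = _ := by ring

end AbsMono

end AbsMono

/-! ### Newton expansions and natural binomial polynomials. -/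

section Newton

variable {σ : Type*} [Fintype σ] [DecidableEq σ] {d : ℕ}

/-- The product of binomial coefficients `∏ a, (y a).choose (m a)`, as a function of `y`. -/
def choosePi (m : σ → ℕ) (y : σ → ℕ) : ℤ := ∏ a, ((y a).choose (m a) : ℤ)

/-- The `ℕ`-linear combinations of products of binomial coefficients in the variables of `s`. -/
def chooseSpan (s : Finset σ) : AddSubmonoid ((σ → ℕ) → ℤ) :=
  AddSubmonoid.closure {g | ∃ m : σ → ℕ, (∀ a ∉ s, m a = 0) ∧ g = choosePi m}

theorem choose_mul_mem_chooseSpan {s : Finset σ} {a : σ} (ha : a ∉ s) (j : ℕ)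
    {g : (σ → ℕ) → ℤ} (hg : g ∈ chooseSpan s) :
    (fun y => ((y a).choose j : ℤ) * g y) ∈ chooseSpan (insert a s) := by
  induction hg using AddSubmonoid.closure_induction with
  | mem g hg =>
    obtain ⟨m, hm, rfl⟩ := hg
    refine AddSubmonoid.subset_closure ⟨Function.update m a j, fun b hb => ?_, ?_⟩
    · rw [Finset.mem_insert, not_or] at hb
      rw [Function.update_of_ne hb.1]
      exact hm b hb.2
    · funext y
      rw [choosePi, choosePi, ← Finset.mul_prod_erase _ _ (Finset.mem_univ a),
        ← Finset.mul_prod_erase (a := a) _ (fun b => ((y b).choose (Function.update m a j b) : ℤ))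
          (Finset.mem_univ a), hm a ha, Function.update_self]
      simp only [Nat.choose_zero_right, Nat.cast_one, one_mul]
      congr 1
      refine Finset.prod_congr rfl fun b hb => ?_
      rw [Function.update_of_ne (Finset.ne_of_mem_erase hb)]
  | zero => simp only [Pi.zero_apply, mul_zero]; exact zero_mem _
  | add f g _ _ hf hg =>
    convert add_mem hf hg using 1
    funext y
    simp [mul_add]

omit [Fintype σ] in
theorem AbsMono.iterate_eq_zero {g : (σ → ℕ) → ℤ} (hg : AbsMono d g) (a : σ) {k : ℕ}
    (hk : d ≤ k) : (_root_.fwdDiff (Pi.single a 1))^[k] g = 0 := by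
  induction k generalizing d g with
  | zero =>
    obtain rfl : d = 0 := by omega
    exact hg
  | succ k ih =>
    rw [Function.iterate_succ_apply]
    cases d with
    | zero => exact ih (hg.fwdDiff_single a) (by omega)
    | succ d => exact ih (hg.2 a) (by omega)

/-- Newton's formula in one variable at a time: the coefficients are iterated differences at `y a =
0`, again absolutely monotone and independent of the coordinate `a`. -/
theorem AbsMono.mem_chooseSpan {g : (σ → ℕ) → ℤ} (hg : AbsMono d g) (s : Finset σ)
    (hs : DependsOn g (s : Set σ)) : g ∈ chooseSpan s := by
  induction s using Finset.induction_on generalizing g with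
  | empty =>
    have : g = (g 0).toNat • choosePi (0 : σ → ℕ) := by
      funext y
      have h1 : g y = g 0 := hs fun i hi => by simp at hi
      have h2 := hg.nonneg 0
      simp [choosePi, h1, h2]
    rw [this]
    have h0 : choosePi (0 : σ → ℕ) ∈ chooseSpan ∅ :=
      AddSubmonoid.subset_closure ⟨0, fun _ _ => rfl, rfl⟩
    exact nsmul_mem h0 _
  | insert a s ha ih =>
    have hexp : g = ∑ j ∈ Finset.range d, fun y => ((y a).choose j : ℤ) *
        (_root_.fwdDiff (Pi.single a 1))^[j] g (Function.update y a 0) := by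
      funext y
      rw [Finset.sum_apply]
      have hy : y = Function.update y a 0 + y a • Pi.single a 1 := by
        funext b
        by_cases hb : b = a
        · subst hb; simp
        · simp [hb]
      have hsh := shift_eq_sum_fwdDiff_iter (Pi.single a 1) g (y a) (Function.update y a 0)
      rw [← hy] at hsh
      rw [hsh]
      simp only [nsmul_eq_mul]
      -- Both ranges extend to a common one: binomials vanish for `j > y a`, iterated differences
      -- for `j ≥ d`.
      trans ∑ j ∈ Finset.range (max d (y a + 1)), ((y a).choose j : ℤ) *
        (_root_.fwdDiff (Pi.single a 1))^[j] g (Function.update y a 0)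
      · refine Finset.sum_subset (Finset.range_mono (le_max_right _ _)) fun j _ hj => ?_
        rw [Nat.choose_eq_zero_of_lt (by simpa using hj)]
        simp
      · symm
        refine Finset.sum_subset (Finset.range_mono (le_max_left _ _)) fun j _ hj => ?_
        rw [hg.iterate_eq_zero a (by simpa using hj)]
        simp
    rw [hexp]
    refine sum_mem fun j _ => choose_mul_mem_chooseSpan ha j (ih ?_ ?_)
    · have hit : ∀ j, AbsMono d ((_root_.fwdDiff (Pi.single a 1))^[j] g) := fun j => by
        induction j with
        | zero => exact hg
        | succ j ih => rw [Function.iterate_succ_apply']; exact ih.fwdDiff_single a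
      refine (hit j).comp (φ := fun y => Function.update y a 0) fun i => ?_
      refine ⟨Function.update (Pi.single i 1) a 0, fun y => ?_⟩
      funext b
      by_cases hb : b = a
      · subst hb; simp
      · simp [hb]
    · have hit : ∀ j, DependsOn ((_root_.fwdDiff (Pi.single a 1))^[j] g)
          ((insert a s : Finset σ) : Set σ) := fun j => by
        induction j with
        | zero => exact hs
        | succ j ih =>
          rw [Function.iterate_succ_apply']
          intro x y hxy
          simp only [_root_.fwdDiff]
          have h1 : ∀ b ∈ ((insert a s : Finset σ) : Set σ),
              (x + Pi.single a 1 : σ → ℕ) b = (y + Pi.single a 1 : σ → ℕ) b := fun b hb => by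
            simp [hxy b hb]
          rw [ih hxy, ih h1]
      intro x y hxy
      refine hit j fun b hb => ?_
      by_cases hba : b = a
      · subst hba; simp
      · rw [Function.update_of_ne hba, Function.update_of_ne hba]
        exact hxy b (by simpa [hba] using hb)

omit [Fintype σ] [DecidableEq σ] in
theorem eval_binomialMonomial_zero (j : σ) (m : ℕ) (y : σ → ℕ) :
    eval (fun i => (y i : ℚ)) (binomialMonomial j 0 m) = (y j).choose m := by
  rw [binomialMonomial, map_mul, map_prod, eval_C]
  simp only [map_sub, eval_X, eval_C, zero_add]
  rw [Finset.prod_range_natCast_sub, ← Nat.descFactorial_eq_prod_range,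
    Nat.choose_eq_descFactorial_div_factorial,
    Nat.cast_div (Nat.factorial_dvd_descFactorial _ _) (by positivity)]
  field_simp

omit [DecidableEq σ] in
theorem IsNaturalBinomial.add {P Q : MvPolynomial σ ℚ} (hP : IsNaturalBinomial P)
    (hQ : IsNaturalBinomial Q) : IsNaturalBinomial (P + Q) := by
  obtain ⟨n, c, l, m, rfl⟩ := hP
  obtain ⟨n', c', l', m', rfl⟩ := hQ
  exact ⟨n + n', Fin.append c c', Fin.append l l', Fin.append m m', by simp [Fin.sum_univ_add]⟩

/-- Newton's expansion of an absolutely monotone function. -/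
theorem AbsMono.exists_isNaturalBinomial {g : (σ → ℕ) → ℤ} (hg : AbsMono d g) :
    ∃ P : MvPolynomial σ ℚ, IsNaturalBinomial P ∧ ∀ y, eval (fun i => (y i : ℚ)) P = g y := by
  have hmem := hg.mem_chooseSpan Finset.univ (fun x y hxy => by
    congr 1; funext b; exact hxy b (by simp))
  clear hg
  induction hmem using AddSubmonoid.closure_induction with
  | mem g hg =>
    obtain ⟨m, -, rfl⟩ := hg
    refine ⟨∏ j, binomialMonomial j 0 (m j), ⟨1, fun _ => 1, fun _ _ => 0, fun _ => m, by simp⟩,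
      fun y => ?_⟩
    simp [choosePi, map_prod, eval_binomialMonomial_zero]
  | zero => exact ⟨0, ⟨0, Fin.elim0, Fin.elim0, Fin.elim0, by simp⟩, by simp⟩
  | add f g _ _ hf hg =>
    obtain ⟨P, hP, hP'⟩ := hf
    obtain ⟨Q, hQ, hQ'⟩ := hg
    exact ⟨P + Q, hP.add hQ, fun y => by simp [hP', hQ']⟩

omit [Fintype σ] [DecidableEq σ] in
theorem eq_of_eval_natCast_mul_eq {P Q : MvPolynomial σ ℚ} {ω : ℕ} (hω : 1 ≤ ω)
    (h : ∀ y : σ → ℕ, eval (fun i => ((ω * y i : ℕ) : ℚ)) P =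
      eval (fun i => ((ω * y i : ℕ) : ℚ)) Q) : P = Q := by
  have hinj : Function.Injective fun n : ℕ => ((ω * n : ℕ) : ℚ) := fun a b hab =>
    Nat.eq_of_mul_eq_mul_left hω (Nat.cast_injective hab)
  refine funext_set (fun _ => Set.range fun n : ℕ => ((ω * n : ℕ) : ℚ))
    (fun _ => Set.infinite_range_of_injective hinj) fun x hx => ?_
  choose y hy using fun i => hx i (Set.mem_univ i)
  obtain rfl : (fun i => ((ω * y i : ℕ) : ℚ)) = x := funext hy
  exact h y

/-- Freezing coordinates preserves absolute monotonicity, and the Newton polynomial of the frozen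
function agrees with the restriction of `P` at all natural points, hence equals it. -/
theorem AbsMono.isStronglyNaturalBinomial {g : (σ → ℕ) → ℤ} (hg : AbsMono d g)
    {P : MvPolynomial σ ℚ} (hP : ∀ y, eval (fun i => (y i : ℚ)) P = g y) :
    IsStronglyNaturalBinomial P := by
  intro ν
  have h1 := hg.comp (φ := fun (y : {j : σ // ν j = none} → ℕ) j =>
    if h : ν j = none then y ⟨j, h⟩ else (ν j).getD 0) (fun i => ⟨Pi.single i.1 1, fun y => by
      funext j
      by_cases h : ν j = none
      · simp [h, Pi.single_apply, Subtype.ext_iff]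
      · have : j ≠ i.1 := fun h' => h (h' ▸ i.2)
        simp [h, this]⟩)
  obtain ⟨Q, hQ, hQ'⟩ := h1.exists_isNaturalBinomial
  have : restrictBy P ν = Q := by
    refine eq_of_eval_natCast_mul_eq le_rfl fun y => ?_
    simp only [one_mul]
    rw [hQ', ← hP, restrictBy, aeval_eq_bind₁, eval, eval, eval₂Hom_bind₁]
    congr 2
    funext j
    by_cases h : ν j = none
    · simp [h]
    · simp [h]
  rwa [this]

end Newton

/-! ### From natural binomial polynomials to non-negative coefficients. -/

section NonnegCoeff

variable {σ τ : Type*}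

/-- The polynomials with non-negative coefficients. -/
def nonnegCoeff (σ : Type*) : Subsemiring (MvPolynomial σ ℚ) where
  carrier := {P | ∀ m, 0 ≤ coeff m P}
  mul_mem' {P Q} hP hQ m := by
    classical
    rw [coeff_mul]
    exact Finset.sum_nonneg fun x _ => mul_nonneg (hP _) (hQ _)
  one_mem' m := by
    classical
    rw [coeff_one]
    positivity
  add_mem' {P Q} hP hQ m := by
    rw [coeff_add]
    exact add_nonneg (hP m) (hQ m)
  zero_mem' m := by simp

theorem C_mem_nonnegCoeff {c : ℚ} (hc : 0 ≤ c) : (C c : MvPolynomial σ ℚ) ∈ nonnegCoeff σ := by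
  classical
  intro m
  rw [coeff_C]
  split_ifs
  exacts [hc, le_rfl]

theorem X_mem_nonnegCoeff (j : σ) : (X j : MvPolynomial σ ℚ) ∈ nonnegCoeff σ := by
  classical
  intro m
  rw [coeff_X]
  split_ifs <;> simp

theorem aeval_mem_nonnegCoeff {P : MvPolynomial σ ℚ} (hP : P ∈ nonnegCoeff σ)
    {q : σ → MvPolynomial τ ℚ} (hq : ∀ j, q j ∈ nonnegCoeff τ) : aeval q P ∈ nonnegCoeff τ := by
  rw [aeval_def, eval₂_eq]
  exact sum_mem fun m _ => mul_mem (C_mem_nonnegCoeff (hP m))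
    (prod_mem fun i _ => pow_mem (hq i) _)

theorem exists_absMono_of_mem_nonnegCoeff [Fintype σ] [DecidableEq σ] {P : MvPolynomial σ ℚ}
    (hP : P ∈ nonnegCoeff σ) : ∃ d, AbsMono d fun y : σ → ℕ => eval (fun i => (y i : ℚ)) P := by
  have hprod : ∀ (s : Finset σ) (m : σ → ℕ), ∃ d,
      AbsMono d fun y : σ → ℕ => ∏ i ∈ s, (y i : ℚ) ^ m i := by
    intro s m
    induction s using Finset.induction_on with
    | empty => exact ⟨1, by simpa using AbsMono.const zero_le_one⟩
    | insert a s ha ih =>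
      obtain ⟨d, hd⟩ := ih
      have hpow : ∀ n : ℕ, ∃ e, AbsMono e fun y : σ → ℕ => (y a : ℚ) ^ n := by
        intro n
        induction n with
        | zero => exact ⟨1, by simpa using AbsMono.const zero_le_one⟩
        | succ n ih =>
          obtain ⟨e, he⟩ := ih
          exact ⟨_, by simpa [pow_succ, Pi.mul_def] using he.mul (AbsMono.coord a)⟩
      obtain ⟨e, he⟩ := hpow (m a)
      exact ⟨_, by simpa [Finset.prod_insert ha, Pi.mul_def] using he.mul hd⟩
  choose D hD using hprod
  refine ⟨∑ m ∈ P.support, (1 + D m.support m), ?_⟩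
  have : (fun y : σ → ℕ => eval (fun i => (y i : ℚ)) P) =
      ∑ m ∈ P.support, fun y => coeff m P * ∏ i ∈ m.support, (y i : ℚ) ^ m i := by
    funext y
    rw [Finset.sum_apply, eval_eq]
  rw [this]
  refine AbsMono.sum _ _ fun m hm => ?_
  exact ((AbsMono.const (hP m)).mul (hD m.support m)).mono
    (Finset.single_le_sum (f := fun m : σ →₀ ℕ => 1 + D m.support m)
      (fun _ _ => Nat.zero_le _) hm)

/-- A large translation turns every factor `X - (ℓ + t)` into `X` plus a non-negative constant. -/
theorem IsNaturalBinomial.exists_shift_mem_nonnegCoeff [Fintype σ] {Q : MvPolynomial σ ℚ}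
    (hQ : IsNaturalBinomial Q) : ∃ L₀ : ℕ, ∀ L : ℕ, L₀ ≤ L →
      aeval (fun j => X j + C (L : ℚ)) Q ∈ nonnegCoeff σ := by
  obtain ⟨n, c, l, m, rfl⟩ := hQ
  refine ⟨∑ i, ∑ j, (l i j + m i j), fun L hL => ?_⟩
  rw [map_sum]
  refine sum_mem fun i _ => ?_
  rw [map_nsmul, map_prod]
  refine nsmul_mem (prod_mem fun j _ => ?_) _
  have hL' : l i j + m i j ≤ L :=
    (Finset.single_le_sum (f := fun j => l i j + m i j) (fun _ _ => Nat.zero_le _)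
      (Finset.mem_univ j)).trans ((Finset.single_le_sum
        (f := fun i => ∑ j, (l i j + m i j)) (fun _ _ => Nat.zero_le _)
        (Finset.mem_univ i)).trans hL)
  rw [binomialMonomial, map_mul, map_prod, algHom_C]
  refine mul_mem (C_mem_nonnegCoeff (by positivity)) (prod_mem fun t ht => ?_)
  rw [Finset.mem_range] at ht
  have : aeval (fun j => X j + C (L : ℚ)) (X j - C ((l i j + t : ℕ) : ℚ) : MvPolynomial σ ℚ) =
      X j + C ((L - (l i j + t) : ℕ) : ℚ) := by
    rw [map_sub, aeval_X, algHom_C, Nat.cast_sub (by omega), C_sub]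
    simp only [algebraMap_eq]
    ring
  rw [this]
  exact add_mem (X_mem_nonnegCoeff j) (C_mem_nonnegCoeff (by positivity))

/-- If a polynomial is a natural binomial polynomial along a sublattice, then it is ultimately
absolutely monotone. -/
theorem IsNaturalBinomial.exists_absMono_shift [Fintype σ] [DecidableEq σ]
    {P Q : MvPolynomial σ ℚ} (hQ : IsNaturalBinomial Q) {ω N₀ : ℕ} (hω : 1 ≤ ω)
    (h : ∀ x : σ → ℕ, (∀ i, N₀ ≤ x i) →
      eval (fun i => ((ω * (x i + 1) : ℕ) : ℚ)) P = eval (fun i => (x i : ℚ)) Q) :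
    ∃ K d : ℕ, N₀ ≤ K ∧
      AbsMono d fun y : σ → ℕ => eval (fun i => ((y i + K : ℕ) : ℚ)) P := by
  obtain ⟨L₀, hL₀⟩ := hQ.exists_shift_mem_nonnegCoeff
  set L := max L₀ N₀ with hL
  have hQ' := hL₀ L (le_max_left _ _)
  -- With this choice `y + K = ω * (x + 1)` for `x = y / ω + L`, so translating `P` by `K` amounts
  -- to translating `Q` by `L` and rescaling by `ω⁻¹`. It suffices to compare the two polynomials on
  -- multiples of `ω`.
  set K := ω * (L + 1) with hK
  have hP' : aeval (fun j => X j + C (K : ℚ)) P =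
      aeval (fun j => C ((ω : ℚ)⁻¹) * X j) (aeval (fun j => X j + C (L : ℚ)) Q) := by
    refine eq_of_eval_natCast_mul_eq hω fun y => ?_
    have h1 := h (fun i => y i + L) fun i => (le_max_right L₀ N₀).trans (Nat.le_add_left _ _)
    have hω' : (ω : ℚ) ≠ 0 := by positivity
    simp only [aeval_eq_bind₁, eval, eval₂Hom_bind₁]
    refine Eq.trans ?_ (h1.trans ?_)
    · rw [eval]
      congr 2
      funext i
      simp only [map_add, coe_eval₂Hom, eval₂_X, eval₂_C, RingHom.id_apply, hK]
      push_cast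
      ring
    · rw [eval]
      congr 2
      funext i
      simp [hω']
  have hmem : aeval (fun j => X j + C (K : ℚ)) P ∈ nonnegCoeff σ := by
    rw [hP']
    exact aeval_mem_nonnegCoeff hQ' fun j =>
      mul_mem (C_mem_nonnegCoeff (by positivity)) (X_mem_nonnegCoeff j)
  obtain ⟨d, hd⟩ := exists_absMono_of_mem_nonnegCoeff hmem
  refine ⟨K, d, ?_, ?_⟩
  · calc N₀ ≤ L := le_max_right _ _
      _ ≤ 1 * (L + 1) := by omega
      _ ≤ K := Nat.mul_le_mul_right _ hω
  · convert hd using 2 with y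
    simp only [aeval_eq_bind₁, eval, eval₂Hom_bind₁]
    congr 2
    funext i
    simp

end NonnegCoeff

/-! ### Recursion for sums over factorizations. -/

section ProductionSum

variable {A : Type*} {M : Type} [Monoid M]

theorem splits_finite (w : FreeMonoid A) :
    {p : FreeMonoid A × FreeMonoid A | p.1 * p.2 = w}.Finite := by
  refine ((factorizations_finite 2 w).image fun u => (u 0, u 1)).subset fun p hp => ?_
  refine ⟨![p.1, p.2], ?_, by simp⟩
  have : p.1 * p.2 = w := hp
  simpa [factorizations] using this

/-- The decompositions of a word into two factors. -/
noncomputable def splits (w : FreeMonoid A) : Finset (FreeMonoid A × FreeMonoid A) :=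
  (splits_finite w).toFinset

theorem mem_splits {w : FreeMonoid A} {p : FreeMonoid A × FreeMonoid A} :
    p ∈ splits w ↔ p.1 * p.2 = w := by
  simp [splits]

theorem sum_splits_one (g : FreeMonoid A × FreeMonoid A → ℤ) : ∑ p ∈ splits 1, g p = g (1, 1) := by
  have : splits (1 : FreeMonoid A) = {(1, 1)} := by
    ext p
    rw [mem_splits, Finset.mem_singleton, mul_eq_one', Prod.ext_iff]
  rw [this, Finset.sum_singleton]

theorem sum_splits_of_mul (g : FreeMonoid A × FreeMonoid A → ℤ) (a : A) (w : FreeMonoid A) :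
    ∑ p ∈ splits (FreeMonoid.of a * w), g p =
      g (1, FreeMonoid.of a * w) + ∑ p ∈ splits w, g (FreeMonoid.of a * p.1, p.2) := by
  classical
  have : splits (FreeMonoid.of a * w) = insert (1, FreeMonoid.of a * w)
      ((splits w).image fun p => (FreeMonoid.of a * p.1, p.2)) := by
    ext ⟨x, y⟩
    rw [mem_splits, Finset.mem_insert, Finset.mem_image]
    constructor
    · intro h
      cases x using FreeMonoid.casesOn with
      | one => left; simpa using h
      | of_mul b x =>
        right
        simp only [mul_assoc] at h
        have h1 := List.cons.inj (show b :: (x * y).toList = a :: w.toList from h)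
        refine ⟨(x, y), mem_splits.2 h1.2, ?_⟩
        rw [h1.1]
    · rintro (h | ⟨p, hp, h⟩)
      · simp only [Prod.mk.injEq] at h
        simp [h.1, h.2]
      · simp only [Prod.mk.injEq] at h
        rw [mem_splits] at hp
        rw [← h.1, ← h.2, mul_assoc, hp]
  rw [this, Finset.sum_insert, Finset.sum_image]
  · rintro ⟨x, y⟩ - ⟨x', y'⟩ - h
    simpa using h
  · rw [Finset.mem_image]
    rintro ⟨p, -, h⟩
    simp only [Prod.mk.injEq] at h
    exact List.cons_ne_nil _ _ h.1

theorem productionSum_one (μ : FreeMonoid A →* M) (π : (Fin 1 → M) → ℤ) (w : FreeMonoid A) :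
    productionSum μ π w = π fun _ => μ w := by
  have : (factorizations_finite 1 w).toFinset = {fun _ => w} := by
    ext u
    simp [factorizations, funext_iff, Fin.forall_fin_one]
  rw [productionSum, this, Finset.sum_singleton]

theorem productionSum_succ {n : ℕ} (μ : FreeMonoid A →* M) (π : (Fin (n + 1) → M) → ℤ)
    (w : FreeMonoid A) : productionSum μ π w =
      ∑ p ∈ splits w, productionSum μ (fun m => π (Fin.cons (μ p.1) m)) p.2 := by
  simp only [productionSum]
  rw [Finset.sum_sigma']
  refine Finset.sum_bij'
    (fun u _ => ⟨(u 0, (List.ofFn (Fin.tail u)).prod), Fin.tail u⟩)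
    (fun q _ => Fin.cons q.1.1 q.2) ?_ ?_ ?_ ?_ ?_
  · intro u hu
    simp only [Set.Finite.mem_toFinset, factorizations, Set.mem_ofPred_eq, List.ofFn_succ,
      List.prod_cons] at hu
    simp only [Finset.mem_sigma, mem_splits, Set.Finite.mem_toFinset, factorizations,
      Set.mem_ofPred_eq, and_true]
    exact hu
  · rintro ⟨⟨x, y⟩, u⟩ hq
    simp only [Finset.mem_sigma, mem_splits, Set.Finite.mem_toFinset, factorizations,
      Set.mem_ofPred_eq] at hq
    simp only [Set.Finite.mem_toFinset, factorizations, Set.mem_ofPred_eq, List.ofFn_succ,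
      List.prod_cons, Fin.cons_zero, Fin.cons_succ, hq.2, hq.1]
  · intro u _
    exact Fin.cons_self_tail u
  · rintro ⟨⟨x, y⟩, u⟩ hq
    simp only [Finset.mem_sigma, mem_splits, Set.Finite.mem_toFinset, factorizations,
      Set.mem_ofPred_eq] at hq
    simp [hq.2]
  · intro u _
    congr 1
    funext i
    refine Fin.cases ?_ (fun j => ?_) i
    · simp
    · simp [Fin.tail]

/-- The first factor is either empty, which saves one factor, or starts with `a`, which the
production function absorbs. -/
theorem productionSum_of_mul {n : ℕ} (μ : FreeMonoid A →* M) (π : (Fin (n + 1) → M) → ℤ)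
    (a : A) (w : FreeMonoid A) : productionSum μ π (FreeMonoid.of a * w) =
      productionSum μ (fun m => π (Fin.cons 1 m)) (FreeMonoid.of a * w) +
        productionSum μ (fun m => π (Fin.cons (μ (FreeMonoid.of a) * m 0) (Fin.tail m))) w := by
  rw [productionSum_succ, sum_splits_of_mul, productionSum_succ μ (fun m => π (Fin.cons _ _))]
  simp

theorem factorizations_prod {n : ℕ} (w : FreeMonoid A) {u : Fin n → FreeMonoid A}
    (hu : u ∈ (factorizations_finite n w).toFinset) (μ : FreeMonoid A →* M) :
    (List.ofFn fun i => μ (u i)).prod = μ w := by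
  have h : (List.ofFn u).prod = w := by simpa [factorizations] using hu
  rw [← h, map_list_prod, List.map_ofFn]
  rfl

end ProductionSum

/-! ### Closure properties of star-free polyregular functions. -/

section StarFree

theorem pow_eq_pow_of_le {M : Type*} [Monoid M] {x : M} {n m : ℕ} (h : x ^ (n + 1) = x ^ n)
    (hm : n ≤ m) : x ^ m = x ^ n := by
  induction hm with
  | refl => rfl
  | step _ ih => rw [pow_succ, ih, ← pow_succ, h]

theorem AperiodicMonoid.prod {M N : Type} [Monoid M] [Monoid N] (hM : AperiodicMonoid M)
    (hN : AperiodicMonoid N) : AperiodicMonoid (M × N) := by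
  rintro ⟨x, y⟩
  obtain ⟨m, hm⟩ := hM x
  obtain ⟨n, hn⟩ := hN y
  refine ⟨max m n, Prod.ext ?_ ?_⟩
  · exact (pow_eq_pow_of_le hm (by omega)).trans (pow_eq_pow_of_le hm (le_max_left _ _)).symm
  · exact (pow_eq_pow_of_le hn (by omega)).trans (pow_eq_pow_of_le hn (le_max_right _ _)).symm

variable {A : Type*} {d : ℕ} {f g : FreeMonoid A → ℤ}

theorem nonneg_of_mem_NSF (hf : f ∈ NSF A d) (w : FreeMonoid A) : 0 ≤ f w := by
  obtain ⟨M, _, _, μ, π, -, hf⟩ := hf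
  rw [hf]
  exact Finset.sum_nonneg fun _ _ => by positivity

theorem add_mem_NSF (hf : f ∈ NSF A d) (hg : g ∈ NSF A d) : f + g ∈ NSF A d := by
  obtain ⟨M, _, _, μ, π, hM, hf⟩ := hf
  obtain ⟨N, _, _, ν, ρ, hN, hg⟩ := hg
  refine ⟨M × N, inferInstance, inferInstance, μ.prod ν,
    fun m => π (fun i => (m i).1) + ρ (fun i => (m i).2), hM.prod hN, fun w => ?_⟩
  rw [Pi.add_apply, hf, hg]
  simp [productionSum, Finset.sum_add_distrib]

/-- The images of the factors multiply to `ν w`, so the production function over the product monoid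
can compute the weight itself. -/
theorem recognizable_mul_mem_NSF (hf : f ∈ NSF A d) {N : Type} [Monoid N] [Finite N]
    (hN : AperiodicMonoid N) (ν : FreeMonoid A →* N) (h : N → ℕ) :
    (fun w => (h (ν w) : ℤ) * f w) ∈ NSF A d := by
  obtain ⟨M, _, _, μ, π, hM, hf⟩ := hf
  refine ⟨M × N, inferInstance, inferInstance, μ.prod ν,
    fun m => h (List.ofFn fun i => (m i).2).prod * π (fun i => (m i).1), hM.prod hN, fun w => ?_⟩
  simp only [hf]
  rw [productionSum, productionSum, Finset.mul_sum]
  refine Finset.sum_congr rfl fun u hu => ?_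
  simp only [MonoidHom.prod_apply]
  rw [factorizations_prod w hu ν]
  push_cast
  rfl

theorem sum_splits_mem_NSF (hf : f ∈ NSF A d) {N : Type} [Monoid N] [Finite N]
    (hN : AperiodicMonoid N) (ν : FreeMonoid A →* N) (h : N → ℕ) :
    (fun w => ∑ p ∈ splits w, (h (ν p.1) : ℤ) * f p.2) ∈ NSF A (d + 1) := by
  obtain ⟨M, _, _, μ, π, hM, hf⟩ := hf
  refine ⟨M × N, inferInstance, inferInstance, μ.prod ν,
    fun m => h (m 0).2 * π (fun i => (m i.succ).1), hM.prod hN, fun w => ?_⟩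
  rw [productionSum_succ]
  refine Finset.sum_congr rfl fun p _ => ?_
  rw [hf, productionSum, productionSum, Finset.mul_sum]
  simp

/-- The monoid recording the last letter of a word, letters being seen through a predicate. -/
def LastLetter : Type := Option Bool

namespace LastLetter

/-- The class of the words whose last letter satisfies the predicate, or of those whose last
letter does not. -/
def letter (b : Bool) : LastLetter := some b

instance : Monoid LastLetter where
  mul x y := match y with
    | none => x
    | some b => some b
  one := none
  mul_assoc x y z := by cases z <;> rfl
  one_mul x := by cases x <;> rfl
  mul_one x := rfl

instance : DecidableEq LastLetter := inferInstanceAs (DecidableEq (Option Bool))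

instance : Finite LastLetter := inferInstanceAs (Finite (Option Bool))

theorem letter_ne_one (b : Bool) : letter b ≠ 1 := nofun

theorem letter_inj {b c : Bool} : letter b = letter c ↔ b = c := Option.some_inj

theorem mul_of_ne_one (x : LastLetter) {y : LastLetter} (hy : y ≠ 1) : x * y = y := by
  cases y with
  | none => exact absurd rfl hy
  | some b => rfl

theorem aperiodicMonoid : AperiodicMonoid LastLetter := by
  intro x
  refine ⟨1, ?_⟩
  rw [pow_succ, pow_one]
  cases x <;> rfl

/-- The morphism recording the last letter of a word. -/
def ofWord (q : A → Bool) : FreeMonoid A →* LastLetter :=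
  FreeMonoid.lift fun b => letter (q b)

theorem ofWord_of (q : A → Bool) (b : A) : ofWord q (FreeMonoid.of b) = letter (q b) :=
  FreeMonoid.lift_eval_of _ _

theorem ofWord_eq_one {q : A → Bool} {x : FreeMonoid A} : ofWord q x = 1 ↔ x = 1 := by
  refine ⟨fun h => ?_, fun h => by rw [h, map_one]⟩
  cases x using FreeMonoid.casesOn with
  | one => rfl
  | of_mul b x =>
    rw [map_mul, ofWord_of] at h
    by_cases hx : ofWord q x = 1
    · rw [hx, mul_one] at h
      exact absurd h (letter_ne_one _)
    · rw [mul_of_ne_one _ hx] at h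
      exact absurd h hx

theorem ofWord_of_mul (q : A → Bool) (b : A) {x : FreeMonoid A} (hx : x ≠ 1) :
    ofWord q (FreeMonoid.of b * x) = ofWord q x := by
  rw [map_mul, mul_of_ne_one _ (mt ofWord_eq_one.1 hx)]

end LastLetter

theorem sum_splits_ite_eq_one [DecidableEq (FreeMonoid A)] (f : FreeMonoid A → ℤ)
    (w : FreeMonoid A) : ∑ p ∈ splits w, (if p.1 = 1 then f p.2 else 0) = f w := by
  rw [Finset.sum_eq_single (1, w)]
  · simp
  · rintro ⟨x, y⟩ hp hne
    rw [mem_splits] at hp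
    refine if_neg fun h => hne ?_
    simp only at h hp
    rw [h, one_mul] at hp
    rw [h, hp]
  · intro h
    exact absurd (mem_splits.2 (one_mul w)) h

/-- The sum of the values of `f` at the suffixes that follow an occurrence of the letter `a`. -/
noncomputable def sumAfter [DecidableEq A] (f : FreeMonoid A → ℤ) (a : A) (w : FreeMonoid A) : ℤ :=
  ∑ p ∈ splits w, ((if LastLetter.ofWord (fun b => decide (b = a)) p.1 = LastLetter.letter true
    then 1 else 0 : ℕ) : ℤ) * f p.2

theorem sumAfter_mem_NSF [DecidableEq A] (hf : f ∈ NSF A d) (a : A) :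
    sumAfter f a ∈ NSF A (d + 1) :=
  sum_splits_mem_NSF hf LastLetter.aperiodicMonoid
    (LastLetter.ofWord fun b => decide (b = a))
    (fun x => if x = LastLetter.letter true then 1 else 0)

theorem sumAfter_one [DecidableEq A] (f : FreeMonoid A → ℤ) (a : A) : sumAfter f a 1 = 0 := by
  rw [sumAfter, sum_splits_one, map_one, if_neg (LastLetter.letter_ne_one _).symm]
  simp

/-- Prepending `b` keeps the last letter of every non-empty prefix, and the only new non-empty
prefix is `b` itself. Thus `sumAfter` inverts the difference in the letter `a`. -/
theorem sumAfter_of_mul [DecidableEq A] (f : FreeMonoid A → ℤ) (a b : A) (w : FreeMonoid A) :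
    sumAfter f a (FreeMonoid.of b * w) = sumAfter f a w + if b = a then f w else 0 := by
  classical
  have hterm : ∀ p : FreeMonoid A × FreeMonoid A,
      ((if LastLetter.ofWord (fun b => decide (b = a)) (FreeMonoid.of b * p.1) =
        LastLetter.letter true then 1 else 0 : ℕ) : ℤ) * f p.2 =
      ((if LastLetter.ofWord (fun b => decide (b = a)) p.1 =
        LastLetter.letter true then 1 else 0 : ℕ) : ℤ) * f p.2 +
      if b = a then (if p.1 = 1 then f p.2 else 0) else 0 := by
    intro p
    by_cases hp : p.1 = 1
    · simp only [hp, mul_one, map_one, LastLetter.ofWord_of, LastLetter.letter_inj,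
        (LastLetter.letter_ne_one _).symm]
      by_cases hb : b = a <;> simp [hb]
    · rw [LastLetter.ofWord_of_mul _ _ hp]
      simp [hp]
  rw [sumAfter, sum_splits_of_mul, map_one, if_neg (LastLetter.letter_ne_one _).symm, sumAfter,
    ← sum_splits_ite_eq_one f w, Nat.cast_zero, zero_mul, zero_add]
  refine (Finset.sum_congr rfl fun p _ => hterm p).trans ?_
  rw [Finset.sum_add_distrib]
  congr 1
  split_ifs <;> simp

/-- The additional factor is forced to be empty; `LastLetter` detects the empty word. -/
theorem mem_NSF_succ (hf : f ∈ NSF A d) : f ∈ NSF A (d + 1) := by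
  classical
  convert sum_splits_mem_NSF hf LastLetter.aperiodicMonoid (LastLetter.ofWord fun _ => true)
    (fun x => if x = 1 then 1 else 0) using 1
  funext w
  rw [← sum_splits_ite_eq_one f w]
  refine Finset.sum_congr rfl fun p _ => ?_
  simp [LastLetter.ofWord_eq_one]

end StarFree

/-! ### Differences of residuals. -/

section Residuals

variable {A : Type*} {d : ℕ} {f g : FreeMonoid A → ℤ}

theorem const_mem_NSF (c d : ℕ) : (fun _ => (c : ℤ)) ∈ NSF A d := by
  induction d with
  | zero =>
    exact ⟨PUnit, inferInstance, inferInstance, 1, fun _ => c, fun x => ⟨0, rfl⟩,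
      fun w => (productionSum_one _ (fun _ => (c : ℤ)) w).symm⟩
  | succ d ih => exact mem_NSF_succ ih

theorem zero_mem_NSFPred (d : ℕ) : (0 : FreeMonoid A → ℤ) ∈ NSFPred A d := by
  cases d with
  | zero => rfl
  | succ d => exact const_mem_NSF 0 d

theorem eq_zero_of_mem_NSFPred_zero (hf : f ∈ NSFPred A 0) : f = 0 := hf

theorem add_mem_NSFPred (hf : f ∈ NSFPred A d) (hg : g ∈ NSFPred A d) : f + g ∈ NSFPred A d := by
  cases d with
  | zero =>
    rw [eq_zero_of_mem_NSFPred_zero hf, eq_zero_of_mem_NSFPred_zero hg, add_zero]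
    exact zero_mem_NSFPred 0
  | succ d => exact add_mem_NSF hf hg

theorem sum_mem_NSFPred {ι : Type*} (s : Finset ι) (f : ι → FreeMonoid A → ℤ)
    (hf : ∀ i ∈ s, f i ∈ NSFPred A d) : ∑ i ∈ s, f i ∈ NSFPred A d :=
  Finset.sum_induction f (· ∈ NSFPred A d) (fun _ _ => add_mem_NSFPred) (zero_mem_NSFPred d) hf

theorem mem_NSFPred_succ (hf : f ∈ NSFPred A d) : f ∈ NSFPred A (d + 1) := by
  cases d with
  | zero =>
    rw [eq_zero_of_mem_NSFPred_zero hf]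
    exact zero_mem_NSFPred 1
  | succ d => exact mem_NSF_succ hf

theorem sumAfter_mem_NSFPred [DecidableEq A] (hf : f ∈ NSFPred A d) (a : A) :
    sumAfter f a ∈ NSFPred A (d + 1) := by
  cases d with
  | zero =>
    rw [eq_zero_of_mem_NSFPred_zero hf]
    convert zero_mem_NSFPred (A := A) 1 using 1
    funext w
    simp [sumAfter]
  | succ d => exact sumAfter_mem_NSF hf a

theorem recognizable_mul_mem_NSFPred (hf : f ∈ NSFPred A d) {N : Type} [Monoid N] [Finite N]
    (hN : AperiodicMonoid N) (ν : FreeMonoid A →* N) (h : N → ℕ) :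
    (fun w => (h (ν w) : ℤ) * f w) ∈ NSFPred A d := by
  cases d with
  | zero =>
    rw [eq_zero_of_mem_NSFPred_zero hf]
    convert zero_mem_NSFPred (A := A) 0 using 1
    funext w
    simp
  | succ d => exact recognizable_mul_mem_NSF hf hN ν h

theorem productionSum_mem_NSF {M : Type} [Monoid M] [Finite M] (hM : AperiodicMonoid M)
    (μ : FreeMonoid A →* M) (π : (Fin (d + 1) → M) → ℕ) :
    productionSum μ (fun m => (π m : ℤ)) ∈ NSF A d :=
  ⟨M, inferInstance, inferInstance, μ, π, hM, fun _ => rfl⟩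

theorem productionSum_of_mul_mem_NSF {M : Type} [Monoid M] [Finite M] (hM : AperiodicMonoid M)
    (μ : FreeMonoid A →* M) (π : (Fin (d + 1) → M) → ℕ) (a : A) :
    (fun w => productionSum μ (fun m => (π m : ℤ)) (FreeMonoid.of a * w)) ∈ NSF A d := by
  induction d with
  | zero =>
    convert productionSum_mem_NSF hM μ (fun m => π fun _ => μ (FreeMonoid.of a) * m 0) using 1
    funext w
    rw [productionSum_one, productionSum_one, map_mul]
  | succ d ih =>
    convert add_mem_NSF (mem_NSF_succ (ih fun m => π (Fin.cons 1 m)))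
      (productionSum_mem_NSF hM μ
        fun m => π (Fin.cons (μ (FreeMonoid.of a) * m 0) (Fin.tail m))) using 1
    funext w
    rw [productionSum_of_mul]
    rfl

theorem mul_left_mem_NSFPred (hf : f ∈ NSFPred A d) (v : FreeMonoid A) :
    (fun w => f (v * w)) ∈ NSFPred A d := by
  induction v using FreeMonoid.inductionOn' generalizing f with
  | one => simpa using hf
  | of_mul a v ih =>
    simp only [mul_assoc]
    refine ih (f := fun w => f (FreeMonoid.of a * w)) ?_
    cases d with
    | zero =>
      rw [eq_zero_of_mem_NSFPred_zero hf]
      exact zero_mem_NSFPred 0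
    | succ d =>
      obtain ⟨M, _, _, μ, π, hM, hf⟩ := hf
      simp only [hf]
      exact productionSum_of_mul_mem_NSF hM μ π a

/-- Absorbing letters `a` into the first factor produces lower-degree residual differences, handled
by induction. After `N₀` absorptions the image of that factor is stable under one more `a`, so the
top-degree parts cancel. The bound `N` precedes `π` because absorption changes `π`. -/
theorem exists_residual_productionSum_mem_NSFPred {M : Type} [Monoid M] [Finite M]
    (hM : AperiodicMonoid M) (μ : FreeMonoid A →* M) (a : A) :
    ∃ N : ℕ, ∀ i, N ≤ i → ∀ π : (Fin (d + 1) → M) → ℕ,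
      (fun w => productionSum μ (fun m => (π m : ℤ)) (FreeMonoid.of a ^ (i + 1) * w) -
        productionSum μ (fun m => (π m : ℤ)) (FreeMonoid.of a ^ i * w)) ∈ NSFPred A d := by
  obtain ⟨N₀, hN₀⟩ := hM (μ (FreeMonoid.of a))
  induction d with
  | zero =>
    refine ⟨N₀, fun i hi π => ?_⟩
    convert zero_mem_NSFPred (A := A) 0 using 1
    funext w
    simp only [productionSum_one, map_mul, map_pow]
    rw [pow_eq_pow_of_le hN₀ hi, pow_eq_pow_of_le hN₀ (hi.trans (Nat.le_succ i)), sub_self]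
    rfl
  | succ d ih =>
    obtain ⟨N, hN⟩ := ih
    set α := μ (FreeMonoid.of a) with hα
    have step : ∀ (j i : ℕ), N ≤ i → ∀ π : (Fin (d + 2) → M) → ℕ,
        (fun w => productionSum μ (fun m => (π (Fin.cons (α ^ j * m 0) (Fin.tail m)) : ℤ))
            (FreeMonoid.of a ^ (i + 1) * w) -
          productionSum μ (fun m => (π (Fin.cons (α ^ j * m 0) (Fin.tail m)) : ℤ))
            (FreeMonoid.of a ^ i * w)) ∈ NSFPred A (d + 1) →
        (fun w => productionSum μ (fun m => (π m : ℤ)) (FreeMonoid.of a ^ (i + j + 1) * w) -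
          productionSum μ (fun m => (π m : ℤ)) (FreeMonoid.of a ^ (i + j) * w)) ∈
            NSFPred A (d + 1) := by
      intro j
      induction j with
      | zero => intro i _ π h; simpa using h
      | succ j ihj =>
        intro i hi π h
        have h1 := mem_NSFPred_succ (hN (i + j + 1) (by omega) fun m => π (Fin.cons 1 m))
        have h2 := ihj i hi (fun m => π (Fin.cons (α * m 0) (Fin.tail m)))
          (by simpa [← mul_assoc, ← pow_succ'] using h)
        convert add_mem_NSFPred h1 h2 using 1
        funext w
        have he := fun i => productionSum_of_mul μ (fun m => (π m : ℤ)) a (FreeMonoid.of a ^ i * w)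
        simp only [← mul_assoc, ← pow_succ'] at he
        rw [Pi.add_apply, ← add_assoc, he (i + j + 1), he (i + j)]
        ring
    refine ⟨N + N₀, fun i hi π => ?_⟩
    obtain ⟨i, rfl⟩ : ∃ i', i = i' + N₀ := ⟨i - N₀, by omega⟩
    refine step N₀ i (by omega) π ?_
    -- What survives the cancellation: the first factor is empty and its slot holds the stable value
    -- `α ^ N₀`.
    have h1 := mul_left_mem_NSFPred (d := d + 1) (productionSum_of_mul_mem_NSF hM μ
      (fun m => π (Fin.cons (α ^ N₀) m)) a) (FreeMonoid.of a ^ i)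
    convert h1 using 1
    funext w
    rw [pow_succ', mul_assoc, productionSum_of_mul]
    simp [← mul_assoc, ← pow_succ, hN₀, ← hα]

theorem exists_residual_mem_NSFPred (hf : f ∈ NSF A d) (a : A) :
    ∃ N : ℕ, (fun w => f (FreeMonoid.of a ^ (N + 1) * w) - f (FreeMonoid.of a ^ N * w)) ∈
      NSFPred A d := by
  obtain ⟨M, _, _, μ, π, hM, hf⟩ := hf
  obtain ⟨N, hN⟩ := exists_residual_productionSum_mem_NSFPred (d := d) hM μ a
  refine ⟨N, ?_⟩
  simp only [hf]
  exact hN N le_rfl π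

theorem resLE_refl (f : FreeMonoid A → ℤ) (k : ℕ) (u : FreeMonoid A) : ResLE f k u u := by
  simp only [ResLE, sub_self]
  exact zero_mem_NSFPred k

theorem ResLE.trans {f : FreeMonoid A → ℤ} {k : ℕ} {u v w : FreeMonoid A} (huv : ResLE f k u v)
    (hvw : ResLE f k v w) : ResLE f k u w := by
  have : (fun x => f (w * x) - f (u * x)) =
      (fun x => f (v * x) - f (u * x)) + fun x => f (w * x) - f (v * x) := by
    funext x
    simp
  rw [ResLE, this]
  exact add_mem_NSFPred huv hvw

end Residuals

/-! ### Parikh vectors and normal forms. -/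

section LetterCount

variable {A : Type*} [DecidableEq A]

/-- The Parikh vector of a word. -/
def parikh (w : FreeMonoid A) : A → ℕ := fun a => w.toList.count a

@[simp]
theorem parikh_one : parikh (1 : FreeMonoid A) = 0 := by
  funext a
  simp [parikh]

@[simp]
theorem parikh_mul (u v : FreeMonoid A) : parikh (u * v) = parikh u + parikh v := by
  funext a
  simp [parikh, FreeMonoid.toList_mul]

@[simp]
theorem parikh_of (a : A) : parikh (FreeMonoid.of a) = Pi.single a 1 := by
  funext b
  rw [parikh, FreeMonoid.toList_of, List.count_singleton, Pi.single_apply]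
  by_cases h : b = a
  · simp [h]
  · simp [h, Ne.symm h]

@[simp]
theorem parikh_pow (u : FreeMonoid A) (n : ℕ) : parikh (u ^ n) = n • parikh u := by
  induction n with
  | zero => simp
  | succ n ih => rw [pow_succ, parikh_mul, ih, succ_nsmul]

theorem parikh_surjective [Fintype A] : Function.Surjective (parikh (A := A)) := by
  intro v
  induction v using tuple_induction with
  | h0 => exact ⟨1, parikh_one⟩
  | hs v a ih =>
    obtain ⟨w, rfl⟩ := ih
    exact ⟨w * FreeMonoid.of a, by simp⟩

theorem Commutative.exists_eq_comp_parikh [Fintype A] {f : FreeMonoid A → ℤ}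
    (hf : Commutative f) : ∃ F : (A → ℕ) → ℤ, f = fun w => F (parikh w) := by
  choose s hs using parikh_surjective (A := A)
  exact ⟨fun v => f (s v), funext fun w => hf _ _ (List.perm_iff_count.2 fun a =>
    (congrFun (hs (parikh w)) a).symm)⟩

/-- The monoid counting up to the threshold `T`. -/
structure TruncCount (T : ℕ) where
  /-- The number counted. -/
  val : ℕ
  val_le : val ≤ T

namespace TruncCount

variable {T : ℕ}

@[ext]
theorem ext {x y : TruncCount T} (h : x.val = y.val) : x = y := by
  cases x
  cases y
  cases h
  rfl

instance : Monoid (TruncCount T) where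
  mul x y := ⟨min (x.val + y.val) T, min_le_right _ _⟩
  one := ⟨0, Nat.zero_le _⟩
  mul_assoc x y z := ext (show min (min (x.val + y.val) T + z.val) T =
    min (x.val + min (y.val + z.val) T) T by omega)
  one_mul x := ext (show min (0 + x.val) T = x.val by have := x.val_le; omega)
  mul_one x := ext (show min (x.val + 0) T = x.val by have := x.val_le; omega)

theorem val_mul (x y : TruncCount T) : (x * y).val = min (x.val + y.val) T := rfl

theorem val_one : (1 : TruncCount T).val = 0 := rfl

instance : Finite (TruncCount T) :=
  Finite.of_injective (fun x => (⟨x.val, Nat.lt_succ_of_le x.val_le⟩ : Fin (T + 1)))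
    fun _ _ h => ext (Fin.ext_iff.1 h)

theorem val_pow (x : TruncCount T) (n : ℕ) : (x ^ n).val = min (n * x.val) T := by
  induction n with
  | zero => simp [val_one]
  | succ n ih =>
    rw [pow_succ, val_mul, ih, Nat.succ_mul]
    omega

theorem aperiodicMonoid : AperiodicMonoid (TruncCount T) := by
  refine fun x => ⟨T, ext ?_⟩
  rw [val_pow, val_pow]
  rcases Nat.eq_zero_or_pos x.val with h | h
  · simp [h]
  · rw [min_eq_right, min_eq_right] <;> nlinarith

variable (T) in
/-- The morphism counting the occurrences of a letter up to the threshold `T`. -/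
def ofWord (a : A) : FreeMonoid A →* TruncCount T where
  toFun w := ⟨min (parikh w a) T, min_le_right _ _⟩
  map_one' := ext (by simp [val_one])
  map_mul' u v := ext (by simp only [val_mul, parikh_mul, Pi.add_apply]; omega)

end TruncCount

theorem threshold_mul_mem_NSFPred {d : ℕ} {f : FreeMonoid A → ℤ} (hf : f ∈ NSFPred A d) (a : A)
    (T : ℕ) (h : ℕ → ℕ) : (fun w => (h (min (parikh w a) T) : ℤ) * f w) ∈ NSFPred A d :=
  recognizable_mul_mem_NSFPred hf TruncCount.aperiodicMonoid (TruncCount.ofWord T a)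
    fun x => h x.val

theorem prod_threshold_mul_mem_NSFPred {d : ℕ} {f : FreeMonoid A → ℤ} (hf : f ∈ NSFPred A d)
    (s : Finset A) (T : ℕ) (h : A → ℕ → ℕ) :
    (fun w => (∏ a ∈ s, (h a (min (parikh w a) T) : ℤ)) * f w) ∈ NSFPred A d := by
  induction s using Finset.induction_on with
  | empty => simpa using hf
  | insert a s ha ih =>
    convert threshold_mul_mem_NSFPred ih a T (h a) using 1
    funext w
    rw [Finset.prod_insert ha, mul_assoc]

variable [Fintype A]

/-- Discrete integration: the value is `g 0` plus the unit differences met while the word is built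
by prepending letters. Each difference has lower degree, and `sumAfter` raises the degree by one. -/
theorem AbsMono.comp_parikh_sub_mem_NSFPred {d : ℕ} {g : (A → ℕ) → ℤ} (hg : AbsMono d g)
    (c : A → ℕ) : (fun w => g (parikh w - c)) ∈ NSFPred A d := by
  induction d generalizing g with
  | zero =>
    rw [AbsMono] at hg
    subst hg
    rfl
  | succ d ih =>
    -- Subtraction is truncated: another `b` changes `parikh w - c` only once the count has reached
    -- `c b`.
    have h1 : ∀ b, (fun w => ((if c b ≤ min (parikh w b) (c b) then 1 else 0 : ℕ) : ℤ) *
        _root_.fwdDiff (Pi.single b 1) g (parikh w - c)) ∈ NSFPred A d := fun b =>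
      threshold_mul_mem_NSFPred (ih (hg.2 b)) b (c b) fun n => if c b ≤ n then 1 else 0
    convert add_mem_NSFPred (d := d + 1) (const_mem_NSF (g 0).toNat d)
      (sum_mem_NSFPred Finset.univ _ fun b _ => sumAfter_mem_NSFPred (h1 b) b) using 1
    funext w
    induction w using FreeMonoid.inductionOn' with
    | one => simp [sumAfter_one, hg.nonneg 0]
    | of_mul a w ihw =>
      simp only [Pi.add_apply, Finset.sum_apply, sumAfter_of_mul, Finset.sum_add_distrib] at ihw ⊢
      rw [← add_assoc, ← ihw, Finset.sum_ite_eq Finset.univ a, if_pos (Finset.mem_univ a)]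
      by_cases h : c a ≤ parikh w a
      · have : parikh (FreeMonoid.of a * w) - c = parikh w - c + Pi.single a 1 := by
          funext b
          by_cases hb : b = a
          · subst hb; simp; omega
          · simp [hb]
        rw [this]
        simp [h, _root_.fwdDiff]
      · have : parikh (FreeMonoid.of a * w) - c = parikh w - c := by
          funext b
          by_cases hb : b = a
          · subst hb; simp; omega
          · simp [hb]
        rw [this]
        simp [h]

/-- Beyond a threshold, `F` is absolutely monotone of degree less than `d` in each set of
coordinates, the others being fixed. -/
def NormalForm (d : ℕ) (F : (A → ℕ) → ℤ) : Prop :=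
  ∃ T : ℕ, ∀ c : A → ℕ, AbsMono d fun y => F (c + fun a => if T ≤ c a then y a else 0)

/-- The counts truncated at `T` split the words into finitely many classes recognized by an
aperiodic monoid; on each class only the saturated coordinates vary. -/
theorem NormalForm.mem_NSFPred {d : ℕ} {F : (A → ℕ) → ℤ} (hF : NormalForm d F) :
    (fun w => F (parikh w)) ∈ NSFPred A d := by
  obtain ⟨T, hT⟩ := hF
  have h1 : ∀ c : A → ℕ, (fun w : FreeMonoid A =>
      (∏ a, ((if min (parikh w a) T = c a then 1 else 0 : ℕ) : ℤ)) *
        F (c + fun a => if T ≤ c a then (parikh w - c) a else 0)) ∈ NSFPred A d := fun c =>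
    prod_threshold_mul_mem_NSFPred ((hT c).comp_parikh_sub_mem_NSFPred c) Finset.univ T
      fun a n => if n = c a then 1 else 0
  convert sum_mem_NSFPred (Fintype.piFinset fun _ : A => Finset.range (T + 1)) _
    fun c _ => h1 c using 1
  funext w
  rw [Finset.sum_apply, Finset.sum_eq_single fun a => min (parikh w a) T]
  · simp only [if_true, Nat.cast_one, Finset.prod_const_one, one_mul]
    congr 1
    funext a
    simp only [Pi.add_apply, Pi.sub_apply]
    split_ifs <;> omega
  · intro c _ hc
    obtain ⟨a, ha⟩ := Function.ne_iff.1 hc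
    rw [Finset.prod_eq_zero (Finset.mem_univ a), zero_mul]
    rw [if_neg (Ne.symm ha), Nat.cast_zero]
  · intro h
    exact absurd (Fintype.mem_piFinset.2 fun a => Finset.mem_range.2 (by omega)) h

theorem NormalForm.of_residuals {d : ℕ} {F : (A → ℕ) → ℤ} (h0 : ∀ v, 0 ≤ F v)
    (h : ∀ a, ∃ N : ℕ, NormalForm d fun v =>
      F (Pi.single a (N + 1) + v) - F (Pi.single a N + v)) : NormalForm (d + 1) F := by
  choose N T hT using h
  -- Large enough for a coordinate past `S` to stay past `T b` after `N b` is removed.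
  set S := ∑ a, (N a + T a) with hS
  have hle : ∀ a, N a + T a ≤ S := fun a =>
    Finset.single_le_sum (f := fun a => N a + T a) (fun _ _ => Nat.zero_le _) (Finset.mem_univ a)
  refine ⟨S, fun c => ⟨h0 _, fun b => ?_⟩⟩
  by_cases hb : S ≤ c b
  · have h1 := (hT b (c - Pi.single b (N b))).comp
      (φ := fun (y : A → ℕ) a => if S ≤ c a then y a else 0)
      (fun i => ⟨fun a => if S ≤ c a then (Pi.single i 1 : A → ℕ) a else 0, fun y => by
        funext a
        simp only [Pi.add_apply]
        split_ifs <;> rfl⟩)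
    convert h1 using 2 with y
    have hsub : ∀ a, S ≤ c a → T b ≤ (c - Pi.single b (N b) : A → ℕ) a := by
      intro a ha
      have := hle b
      by_cases hab : a = b
      · subst hab; simp; omega
      · rw [Pi.sub_apply, Pi.single_eq_of_ne hab]; omega
    have hbN := hle b
    simp only [_root_.fwdDiff]
    congr 2 <;> funext a <;> have ha := hsub a <;> by_cases hab : a = b
    · subst hab
      simp only [Pi.add_apply, Pi.sub_apply, Pi.single_eq_same, hb, forall_true_left] at ha ⊢
      simp only [ha, if_true]
      omega
    · simp only [Pi.add_apply, Pi.sub_apply, Pi.single_eq_of_ne hab] at ha ⊢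
      split_ifs <;> omega
    · subst hab
      simp only [Pi.add_apply, Pi.sub_apply, Pi.single_eq_same, hb, forall_true_left] at ha ⊢
      simp only [ha, if_true]
      omega
    · simp only [Pi.add_apply, Pi.sub_apply, Pi.single_eq_of_ne hab] at ha ⊢
      split_ifs <;> omega
  · convert AbsMono.zero (σ := A) (R := ℤ) d using 1
    funext y
    simp only [_root_.fwdDiff, Pi.zero_apply, sub_eq_zero]
    congr 2
    funext a
    by_cases hab : a = b
    · subst hab; simp [hb]
    · simp [hab]

/-- For the converse, residual differences of a star-free function drop one degree, so induction and
`NormalForm.of_residuals` apply. -/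
theorem normalForm_iff {d : ℕ} {F : (A → ℕ) → ℤ} :
    NormalForm d F ↔ (fun w => F (parikh w)) ∈ NSFPred A d := by
  refine ⟨NormalForm.mem_NSFPred, fun h => ?_⟩
  induction d generalizing F with
  | zero =>
    have : F = 0 := funext fun v => by
      obtain ⟨w, rfl⟩ := parikh_surjective v
      exact congrFun (eq_zero_of_mem_NSFPred_zero h) w
    subst this
    exact ⟨0, fun c => AbsMono.zero 0⟩
  | succ d ih =>
    refine NormalForm.of_residuals (fun v => ?_) fun a => ?_
    · obtain ⟨w, rfl⟩ := parikh_surjective v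
      exact nonneg_of_mem_NSF h w
    · obtain ⟨N, hN⟩ := exists_residual_mem_NSFPred h a
      refine ⟨N, ih ?_⟩
      simpa [← Pi.single_smul] using hN

/-- The residual difference is a difference of `F` in direction `parikh v - parikh u`, which moves
only coordinates past `T` and so costs one degree. -/
theorem NormalForm.resLE {k T : ℕ} {F : (A → ℕ) → ℤ}
    (hT : ∀ c : A → ℕ, AbsMono (k + 1) fun y => F (c + fun a => if T ≤ c a then y a else 0))
    {u v : FreeMonoid A} (huv : ∀ a, parikh u a = parikh v a ∨ T ≤ parikh u a ∧
      parikh u a ≤ parikh v a) : ResLE (fun w => F (parikh w)) k u v := by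
  have h : NormalForm k fun x => F (parikh v + x) - F (parikh u + x) := by
    refine ⟨T, fun c => ?_⟩
    have h1 := ((hT (parikh u + c)).fwdDiff (parikh v - parikh u)).comp
      (φ := fun (y : A → ℕ) a => if T ≤ c a then y a else 0)
      (fun i => ⟨fun a => if T ≤ c a then (Pi.single i 1 : A → ℕ) a else 0, fun y => by
        funext a
        simp only [Pi.add_apply]
        split_ifs <;> rfl⟩)
    convert h1 using 2 with y
    simp only [_root_.fwdDiff]
    congr 2 <;> funext a <;> have ha := huv a <;> simp only [Pi.add_apply, Pi.sub_apply] <;>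
      split_ifs <;> omega
  simpa [ResLE] using h.mem_NSFPred

theorem NormalForm.isWQO_aperiodicOrdering {k : ℕ} {F : (A → ℕ) → ℤ}
    (hF : NormalForm (k + 1) F) : IsWQO (ResLE (fun w => F (parikh w)) k) ∧
      AperiodicOrdering (ResLE (fun w => F (parikh w)) k) := by
  obtain ⟨T, hT⟩ := hF
  refine ⟨⟨resLE_refl _ k, fun _ _ _ => ResLE.trans, fun s => ?_⟩, fun u w => ⟨T, ?_⟩⟩
  -- Comparing `min x T` by equality and `x` by size gives this relation; its power over `A` is
  -- again a well-quasi-ordering.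
  · have h1 : WellQuasiOrdered fun x y : ℕ => x = y ∨ T ≤ x ∧ x ≤ y := by
      intro x
      obtain ⟨i, j, hij, h⟩ := ((Finite.wellQuasiOrdered (α := Fin (T + 1)) (· = ·)).prod
        (wellQuasiOrdered_le (α := ℕ))) fun n => (⟨min (x n) T, by omega⟩, x n)
      refine ⟨i, j, hij, ?_⟩
      have h2 := Fin.ext_iff.1 h.1
      have h3 : x i ≤ x j := h.2
      simp only at h2
      omega
    have : IsPreorder ℕ fun x y : ℕ => x = y ∨ T ≤ x ∧ x ≤ y :=
      { refl := fun _ => Or.inl rfl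
        trans := fun _ _ _ _ _ => by omega }
    obtain ⟨i, j, hij, h⟩ := WellQuasiOrdered.pi (ι := A) (fun _ => h1) fun n => parikh (s n)
    exact ⟨i, j, hij, NormalForm.resLE hT h⟩
  · intro m n hm hmn
    refine NormalForm.resLE hT fun a => ?_
    simp only [parikh_mul, parikh_pow, Pi.add_apply, Pi.smul_apply, smul_eq_mul]
    rcases Nat.eq_zero_or_pos (parikh w a) with h | h
    · simp [h]
    · right
      constructor <;> nlinarith

theorem NormalForm.of_aperiodicOrdering {k : ℕ} {F : (A → ℕ) → ℤ} (h0 : ∀ v, 0 ≤ F v)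
    (h : AperiodicOrdering (ResLE (fun w => F (parikh w)) k)) : NormalForm (k + 1) F := by
  refine NormalForm.of_residuals h0 fun a => ?_
  obtain ⟨N, hN⟩ := h 1 (FreeMonoid.of a)
  refine ⟨N, normalForm_iff.2 ?_⟩
  simpa [ResLE, ← Pi.single_smul] using hN N (N + 1) le_rfl (Nat.le_succ N)

end LetterCount

/-! ### Pumping patterns of functions in normal form. -/

section Patterns

variable {A : Type*} [DecidableEq A] {p d : ℕ}

theorem parikh_list_prod (l : List (FreeMonoid A)) : parikh l.prod = (l.map parikh).sum := by
  induction l with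
  | nil => simp
  | cons u l ih => simp [ih]

theorem parikh_pumping (α₀ : FreeMonoid A) (u α : Fin p → FreeMonoid A) (x : Fin p → ℕ) :
    parikh (pumping α₀ u α x) =
      (parikh α₀ + ∑ i, parikh (α i)) + ∑ i, x i • parikh (u i) := by
  rw [pumping, parikh_mul, parikh_list_prod, List.map_ofFn, List.sum_ofFn]
  simp only [Function.comp_apply, parikh_mul, parikh_pow, Finset.sum_add_distrib]
  abel

theorem parikh_pumping_add (α₀ : FreeMonoid A) (u α : Fin p → FreeMonoid A) (x y : Fin p → ℕ) :
    parikh (pumping α₀ u α (x + y)) =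
      parikh (pumping α₀ u α x) + ∑ i, y i • parikh (u i) := by
  simp only [parikh_pumping, Pi.add_apply, add_smul, Finset.sum_add_distrib, add_assoc]

theorem le_parikh_pumping (α₀ : FreeMonoid A) (u α : Fin p → FreeMonoid A) (x : Fin p → ℕ)
    {i : Fin p} {a : A} (ha : parikh (u i) a ≠ 0) : x i ≤ parikh (pumping α₀ u α x) a := by
  rw [parikh_pumping, Pi.add_apply, Finset.sum_apply]
  have h1 := Finset.single_le_sum (f := fun i => (x i • parikh (u i)) a)
    (fun _ _ => Nat.zero_le _) (Finset.mem_univ i)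
  have h2 : x i ≤ x i * parikh (u i) a := Nat.le_mul_of_pos_right _ (Nat.pos_of_ne_zero ha)
  simp only [Pi.smul_apply, smul_eq_mul] at h1
  simp only [Pi.smul_apply, smul_eq_mul]
  omega

variable [Fintype A] {F : (A → ℕ) → ℤ}

theorem absMono_linear {T : ℕ}
    (hT : ∀ c : A → ℕ, AbsMono d fun y => F (c + fun a => if T ≤ c a then y a else 0))
    (c : A → ℕ) (u : Fin p → A → ℕ) (hu : ∀ i a, u i a ≠ 0 → T ≤ c a) :
    AbsMono d fun y : Fin p → ℕ => F (c + ∑ i, y i • u i) := by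
  have h1 := (hT c).comp (φ := fun y : Fin p → ℕ => ∑ i, y i • u i) fun i => ⟨u i, fun y => by
    simp [add_smul, Finset.sum_add_distrib, Pi.single_apply, ite_smul]⟩
  convert h1 using 3 with y
  congr 1
  funext a
  split_ifs with h
  · rfl
  · rw [Finset.sum_apply]
    refine Finset.sum_eq_zero fun i _ => ?_
    have : u i a = 0 := by
      by_contra h'
      exact h (hu i a h')
    simp [this]

/-- After `N ≥ T` copies of each `u i`, every letter occurring in some `u i` has count at least `T`,
so further pumping moves only free coordinates. -/
theorem absMono_pumping {T : ℕ}
    (hT : ∀ c : A → ℕ, AbsMono d fun y => F (c + fun a => if T ≤ c a then y a else 0))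
    (α₀ : FreeMonoid A) (u α : Fin p → FreeMonoid A) {N : ℕ} (hN : T ≤ N) (ω : ℕ) :
    AbsMono d fun y : Fin p → ℕ => F (parikh (pumping α₀ u α ((fun _ => N) + ω • y))) := by
  have := absMono_linear hT (parikh (pumping α₀ u α fun _ => N)) (fun i => ω • parikh (u i))
    fun i a ha => hN.trans (le_parikh_pumping α₀ u α (fun _ => N) (i := i)
      fun h => ha (by simp [h]))
  convert this using 3 with y
  rw [parikh_pumping_add]
  congr 1
  refine Finset.sum_congr rfl fun i _ => ?_
  rw [Pi.smul_apply, smul_eq_mul, mul_comm, mul_smul]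

theorem NormalForm.ultimatelyPolynomial (hF : NormalForm d F) :
    UltimatelyPolynomial fun w => F (parikh w) := by
  obtain ⟨T, hT⟩ := hF
  refine ⟨T, fun p α₀ u α => ?_⟩
  obtain ⟨P, -, hP⟩ := (absMono_pumping hT α₀ u α le_rfl 1).exists_isNaturalBinomial
  refine ⟨aeval (fun j => X j - C (T : ℚ)) P, fun x hx => ?_⟩
  have h1 := hP fun i => x i - T
  have hx' : (fun _ => T) + 1 • (fun i => x i - T) = x := by
    funext i
    have := hx i
    simp only [one_smul, Pi.add_apply]
    omega
  rw [hx'] at h1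
  rw [← h1]
  simp only [aeval_eq_bind₁, eval, eval₂Hom_bind₁]
  congr 2
  funext i
  simp [Nat.cast_sub (hx i)]

theorem NormalForm.combinatorial (hF : NormalForm d F) (p : ℕ) :
    Combinatorial p fun w => F (parikh w) := by
  obtain ⟨T, hT⟩ := hF
  -- With `ω = T + 1`, the exponents `ω * (x + 1)` start past `T` and advance by `ω`; adding one
  -- ensures `ω ≥ 1`.
  refine ⟨T + 1, Nat.le_add_left _ _, fun α₀ u α => ?_⟩
  have h1 := absMono_pumping hT α₀ u α (Nat.le_succ T) (T + 1)
  obtain ⟨P, -, hP⟩ := h1.exists_isNaturalBinomial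
  refine ⟨P, h1.isStronglyNaturalBinomial hP, fun x => ?_⟩
  rw [hP]
  congr 4
  funext i
  simp only [Pi.add_apply, Pi.smul_apply, smul_eq_mul, Nat.succ_eq_add_one]
  ring

end Patterns

/-! ### Polynomial growth of polyregular functions. -/

section Growth

variable {A : Type*}

theorem card_splits (w : FreeMonoid A) : (splits w).card = w.length + 1 := by
  have h : (∑ p ∈ splits w, 1 : ℤ) = w.length + 1 := by
    induction w using FreeMonoid.inductionOn' with
    | one => rw [sum_splits_one]; simp
    | of_mul a w ih =>
      rw [sum_splits_of_mul, ih, FreeMonoid.length_mul, FreeMonoid.length_of]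
      push_cast
      ring
  rw [Finset.sum_const, nsmul_eq_mul, mul_one] at h
  exact_mod_cast h

/-- Each of the `d` cuts has at most `w.length + 1` positions. -/
theorem productionSum_le {M : Type} [Monoid M] {d : ℕ} (μ : FreeMonoid A →* M)
    (π : (Fin (d + 1) → M) → ℤ) {C : ℕ} (hC : ∀ m, π m ≤ C) (w : FreeMonoid A) :
    productionSum μ π w ≤ C * (w.length + 1 : ℤ) ^ d := by
  induction d generalizing w with
  | zero => simpa [productionSum_one] using hC _
  | succ d ih =>
    rw [productionSum_succ]
    have h1 : ∀ p ∈ splits w, productionSum μ (fun m => π (Fin.cons (μ p.1) m)) p.2 ≤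
        C * (w.length + 1 : ℤ) ^ d := by
      intro p hp
      refine (ih _ (fun m => hC _) p.2).trans ?_
      have : p.2.length ≤ w.length := by
        rw [← mem_splits.1 hp, FreeMonoid.length_mul]
        omega
      gcongr
    refine (Finset.sum_le_card_nsmul _ _ _ h1).trans_eq ?_
    rw [card_splits, nsmul_eq_mul, pow_succ]
    push_cast
    ring

theorem exists_growth_of_mem_ZPoly {f : FreeMonoid A → ℤ} {k : ℕ} (hf : f ∈ ZPoly A k) :
    ∃ C : ℕ, ∀ w, f w ≤ C * (w.length + 1 : ℤ) ^ k := by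
  obtain ⟨M, _, _, μ, π, hf⟩ := hf
  obtain ⟨C, hC⟩ := (Set.finite_range π).bddAbove
  refine ⟨C.toNat, fun w => ?_⟩
  rw [hf]
  exact productionSum_le μ π
    (fun m => (hC (Set.mem_range_self m)).trans (Int.self_le_toNat C)) w

theorem length_eq_sum_parikh [Fintype A] [DecidableEq A] (w : FreeMonoid A) :
    w.length = ∑ a, parikh w a := by
  induction w using FreeMonoid.inductionOn' with
  | one => simp
  | of_mul a w ih =>
    rw [FreeMonoid.length_mul, FreeMonoid.length_of, ih]
    simp [Finset.sum_add_distrib]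

end Growth

/-! ### From pumping patterns back to the normal form. -/

section Combinatorial

theorem IsNaturalBinomial.rename {σ τ : Type*} [Fintype σ] [Fintype τ] (e : σ ≃ τ)
    {P : MvPolynomial σ ℚ} (hP : IsNaturalBinomial P) :
    IsNaturalBinomial (MvPolynomial.rename e P) := by
  obtain ⟨n, c, l, m, rfl⟩ := hP
  refine ⟨n, c, fun i j => l i (e.symm j), fun i j => m i (e.symm j), ?_⟩
  rw [map_sum]
  refine Finset.sum_congr rfl fun i _ => ?_
  rw [map_nsmul, map_prod]
  congr 1
  refine Fintype.prod_equiv e _ _ fun j => ?_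
  simp [binomialMonomial]

theorem IsStronglyNaturalBinomial.isNaturalBinomial {σ : Type*} [Fintype σ]
    {P : MvPolynomial σ ℚ} (hP : IsStronglyNaturalBinomial P) : IsNaturalBinomial P := by
  have h1 := (hP fun _ => none).rename (Equiv.subtypeUnivEquiv fun _ => rfl)
  convert h1 using 1
  rw [restrictBy, ← AlgHom.comp_apply, comp_aeval]
  simp

variable {A : Type*} [Fintype A] [DecidableEq A] {F : (A → ℕ) → ℤ} {k : ℕ}

/-- The pattern pumps each letter of `J` separately, with `α₀` carrying the values `ν` and empty
words filling the other slots. Its ultimate polynomial is natural binomial along a sublattice, hence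
absolutely monotone after a shift, and growth bounds the degree. -/
theorem Combinatorial.exists_absMono (hu : UltimatelyPolynomial fun w => F (parikh w))
    (hc : Combinatorial (Fintype.card A) fun w => F (parikh w)) {C : ℕ}
    (hC : ∀ w, F (parikh w) ≤ C * (w.length + 1 : ℤ) ^ k) (J : Finset A) (ν : A → ℕ) :
    ∃ K : ℕ, AbsMono (k + 1) fun y : A → ℕ => F fun a => if a ∈ J then y a + K else ν a := by
  obtain ⟨N₀, hu⟩ := hu
  obtain ⟨ω, hω, hc⟩ := hc
  let e := Fintype.equivFin A
  obtain ⟨α₀, hα₀⟩ := parikh_surjective fun a => if a ∈ J then 0 else ν a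
  let u : Fin (Fintype.card A) → FreeMonoid A :=
    fun i => if e.symm i ∈ J then FreeMonoid.of (e.symm i) else 1
  have hpump : ∀ x : Fin (Fintype.card A) → ℕ,
      parikh (pumping α₀ u (fun _ => 1) x) = fun a => if a ∈ J then x (e a) else ν a := by
    intro x
    rw [parikh_pumping, hα₀, ← e.sum_comp (fun i => x i • parikh (u i))]
    funext b
    have h1 : ∀ a, (x (e a) • parikh (u (e a))) b =
        if a = b then (if b ∈ J then x (e b) else 0) else 0 := by
      intro a
      simp only [u, Equiv.symm_apply_apply, Pi.smul_apply, smul_eq_mul]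
      by_cases hab : a = b
      · subst hab
        by_cases ha : a ∈ J <;> simp [ha]
      · split_ifs <;> simp [Ne.symm hab]
    simp only [Pi.add_apply, Finset.sum_apply, h1, parikh_one,
      Finset.sum_const_zero, add_zero, Finset.sum_ite_eq', Finset.mem_univ, if_true]
    split_ifs <;> simp
  obtain ⟨P, hP⟩ := hu _ α₀ u fun _ => 1
  obtain ⟨Q, hQ, hPQ⟩ := hc α₀ u fun _ => 1
  simp only [hpump] at hP hPQ
  obtain ⟨K, d, hK, hd⟩ := hQ.isNaturalBinomial.exists_absMono_shift hω (P := P) (N₀ := N₀)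
    fun x hx => by
      rw [← hPQ, ← hP (fun i => ω * (x i + 1)) fun i => ?_]
      exact (hx i).trans ((Nat.le_succ _).trans (Nat.le_mul_of_pos_left _ hω))
  refine ⟨K, AbsMono.of_growth (d := d)
    -- For `t ≥ 1`, this base times `t` bounds the length plus one of a word whose counts are `t +
    -- K` on `J` and `ν` elsewhere.
    (C := C * ((Fintype.card A * (1 + K) + ∑ a, ν a + 1 : ℕ) : ℤ) ^ k) ?_ k ?_⟩
  · refine AbsMono.of_cast (R := ℚ) ?_
    convert hd.comp (φ := fun (y : A → ℕ) i => y (e.symm i))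
      (fun a => ⟨fun i => (Pi.single a 1 : A → ℕ) (e.symm i), fun y => rfl⟩) using 2 with y
    rw [← hP (fun i => y (e.symm i) + K) fun i => hK.trans (Nat.le_add_left _ _)]
    simp
  · intro t ht
    obtain ⟨w, hw⟩ := parikh_surjective fun a => if a ∈ J then t + K else ν a
    have h1 := hC w
    rw [hw] at h1
    refine h1.trans ?_
    rw [mul_assoc, ← mul_pow]
    have h2 : w.length + 1 ≤ (Fintype.card A * (1 + K) + ∑ a, ν a + 1) * t := by
      rw [length_eq_sum_parikh, hw]
      have h3 : ∑ a, (if a ∈ J then t + K else ν a) ≤ ∑ a, (t + K + ν a) :=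
        Finset.sum_le_sum fun a _ => by split_ifs <;> omega
      rw [Finset.sum_add_distrib, Finset.sum_const, Finset.card_univ, smul_eq_mul] at h3
      have h4 : Fintype.card A * (t + K) ≤ Fintype.card A * (1 + K) * t := by
        rw [mul_assoc]
        exact Nat.mul_le_mul_left _ (by nlinarith)
      have h5 : ∑ a, ν a + 1 ≤ (∑ a, ν a + 1) * t := Nat.le_mul_of_pos_right _ ht
      rw [add_assoc, add_mul]
      simp only
      omega
    have h5 : (w.length + 1 : ℤ) ≤
        ((Fintype.card A * (1 + K) + ∑ a, ν a + 1 : ℕ) : ℤ) * t := by exact_mod_cast h2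
    gcongr

/-- Induction on the complement of `J`. If some coordinate outside `J` is large, the case of a
larger set applies with that coordinate frozen; otherwise only finitely many frozen values `ν`
occur. -/
theorem exists_uniform_absMono
    (h : ∀ (J : Finset A) (ν : A → ℕ), ∃ K : ℕ,
      AbsMono k fun y : A → ℕ => F fun a => if a ∈ J then y a + K else ν a) (J : Finset A) :
    ∃ T : ℕ, ∀ c : A → ℕ, (∀ a ∈ J, T ≤ c a) →
      AbsMono k fun y => F (c + fun a => if a ∈ J then y a else 0) := by
  induction hn : Jᶜ.card using Nat.strong_induction_on generalizing J with
  | _ n ih =>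
    have h1 : ∀ b, ∃ T : ℕ, b ∉ J → ∀ c : A → ℕ, (∀ a ∈ insert b J, T ≤ c a) →
        AbsMono k fun y => F (c + fun a => if a ∈ insert b J then y a else 0) := by
      intro b
      by_cases hb : b ∈ J
      · exact ⟨0, fun h => absurd hb h⟩
      · obtain ⟨T, hT⟩ := ih _ (hn ▸ Finset.card_lt_card
          (Finset.compl_ssubset_compl.2 (Finset.ssubset_insert hb))) (insert b J) rfl
        exact ⟨T, fun _ => hT⟩
    choose T hT using h1
    choose K hK using h J
    -- `S` dominates the thresholds of the larger sets, and `R` dominates `K ν` for all `ν` bounded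
    -- by `S`.
    set S := ∑ b, T b with hS
    set R := ∑ ν ∈ Fintype.piFinset fun _ : A => Finset.range (S + 1), K ν with hR
    have hTS : ∀ b, T b ≤ S := fun b =>
      Finset.single_le_sum (fun _ _ => Nat.zero_le _) (Finset.mem_univ b)
    refine ⟨S + R, fun c hc => ?_⟩
    by_cases hex : ∃ b, b ∉ J ∧ S ≤ c b
    · obtain ⟨b, hb, hbS⟩ := hex
      have h2 := (hT b hb c fun a ha => by
        have := hTS b
        rcases Finset.mem_insert.1 ha with rfl | ha
        · omega
        · have := hc a ha
          omega).comp (φ := fun (y : A → ℕ) a => if a ∈ J then y a else 0)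
        (fun i => ⟨fun a => if a ∈ J then (Pi.single i 1 : A → ℕ) a else 0, fun y => by
          funext a
          simp only [Pi.add_apply]
          split_ifs <;> rfl⟩)
      convert h2 using 4 with y
      funext a
      by_cases ha : a ∈ J <;> simp [ha]
    · push Not at hex
      set ν : A → ℕ := fun a => if a ∈ J then 0 else c a with hν
      have hνmem : ν ∈ Fintype.piFinset fun _ : A => Finset.range (S + 1) := by
        refine Fintype.mem_piFinset.2 fun a => Finset.mem_range.2 ?_
        simp only [hν]
        split_ifs with ha
        · omega
        · exact (hex a ha).trans (Nat.lt_succ_self S)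
      have hKR : K ν ≤ R := Finset.single_le_sum (fun _ _ => Nat.zero_le _) hνmem
      convert (hK ν).shift (c - fun _ => K ν) using 3 with y
      funext a
      simp only [Pi.add_apply, Pi.sub_apply]
      by_cases ha : a ∈ J
      · have := hc a ha
        simp only [ha, if_true]
        omega
      · simp [ha, hν]

theorem Combinatorial.normalForm (hu : UltimatelyPolynomial fun w => F (parikh w))
    (hc : Combinatorial (Fintype.card A) fun w => F (parikh w))
    (hF : (fun w => F (parikh w)) ∈ ZPoly A k) : NormalForm (k + 1) F := by
  obtain ⟨C, hC⟩ := exists_growth_of_mem_ZPoly hF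
  choose T hT using exists_uniform_absMono (F := F) (k := k + 1)
    fun J ν => Combinatorial.exists_absMono hu hc hC J ν
  refine ⟨∑ J, T J, fun c => ?_⟩
  -- The set of free coordinates depends on `c`; summing the thresholds over all `J` makes one bound
  -- serve every such set.
  have := hT {a | ∑ J, T J ≤ c a} c fun a ha =>
    (Finset.single_le_sum (fun _ _ => Nat.zero_le _) (Finset.mem_univ _)).trans
      (Finset.mem_filter.1 ha).2
  simpa using this

end Combinatorial

end Polyreg

/-! ### The equivalences, through the normal form. -/

theorem mainTheorem8 {A : Type*} [Fintype A] (k : ℕ) (f : FreeMonoid A → ℤ)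
    (hf : f ∈ Polyreg.ZPoly A k) (hcomm : Polyreg.Commutative f) :
    List.TFAE [
      f ∈ Polyreg.NSF A k,
      (∀ w, 0 ≤ f w) ∧ Polyreg.IsWQO (Polyreg.ResLE f k) ∧
        Polyreg.AperiodicOrdering (Polyreg.ResLE f k),
      Polyreg.UltimatelyPolynomial f ∧ Polyreg.Combinatorial (Fintype.card A) f] := by
  classical
  obtain ⟨F, rfl⟩ := hcomm.exists_eq_comp_parikh
  have hiff : Polyreg.NormalForm (k + 1) F ↔ (fun w => F (Polyreg.parikh w)) ∈ Polyreg.NSF A k :=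
    Polyreg.normalForm_iff
  tfae_have 1 → 2 := fun h =>
    ⟨Polyreg.nonneg_of_mem_NSF h, (hiff.2 h).isWQO_aperiodicOrdering⟩
  tfae_have 2 → 1 := fun ⟨h0, _, h⟩ => hiff.1 <| Polyreg.NormalForm.of_aperiodicOrdering
    (fun v => by
      obtain ⟨w, rfl⟩ := Polyreg.parikh_surjective v
      exact h0 w) h
  tfae_have 1 → 3 := fun h => ⟨(hiff.2 h).ultimatelyPolynomial, (hiff.2 h).combinatorial _⟩
  tfae_have 3 → 1 := fun ⟨hu, hc⟩ => hiff.1 (Polyreg.Combinatorial.normalForm hu hc hf)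
  tfae_finish
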